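/- **Automaton and augmented construction.** Let $\mathcal A$ be a $(\min,+)$ weighted finite automaton with finite state set $Q$, finite alphabet $\Sigma$, initial state $q_0$, and exactly one weight $\mathrm{wt}(p,\sigma,q)\in\mathbb Z\cup\{\infty\}$ for every $(p,\sigma,q)$ ($\infty$ = no transition). Let $S=\{(p,q,T): T\subseteq Q,\ p,q\in T\}$, where $q$ is the *baseline component*; states $(p,p,T)$ are *baseline states*, and $s_0=(q_0,q_0,\{q_0\})$. Put $\mathfrak m=|S|\cdot|S|!$. Words below are over letters acting on $S$ by min-plus matrices; $\mathrm{mwt}(w,s\to r)$ is the minimal weight of a run from $s$ to $r$ on $w$ ($\infty$ if there is none). A *standard letter* is a transition $(p,\sigma,c,q)$ of $\mathcal A$ (so $c=\mathrm{wt}(p,\sigma,q)$); on it, $(p',p,T)$ goes to $(q',q,T')$ with weight $\mathrm{wt}(p',\sigma,q')-c$, where $T'$ is the set of states reachable from $T$ by $\sigma$. There are no other transitions on it (and none if $c=\infty$). **Cycles.** For $S'=\{(p,q,T):p\in T\}$ and a word $w$, $(S',w)$ is a *reflexive cycle* if all runs on $w$ from $S'$ end in $S'$. Let $\mathrm{MinStates}(S',w)$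 be the set of $s\in S'$ with $\mathrm{mwt}(w,s\to s)<\infty$ minimal among all $\mathrm{mwt}(w,r\to r)$, $r\in S'$. $(S',w)$ is a *stable cycle* if it is a reflexive cycle and the baseline state $s$ of $S'$ satisfies, for all $n$, $s\in\mathrm{MinStates}(S',w^n)$ and $\mathrm{mwt}(w^n,s\to s)=0$. A pair $(s,r)\in S'\times S'$ is *grounded* if $\mathrm{mwt}(w^{\mathfrak m},s\to g)$ and $\mathrm{mwt}(w^{\mathfrak m},g\to r)$ are finite for some $g\in\mathrm{MinStates}(S',w^{\mathfrak m})$. $(S',w)$ is *degenerate* if for all $s\in S'$ and all $t\in S'$ with $\mathrm{mwt}(w^{2\mathfrak m},t\to t)<\infty$, whenever $\mathrm{mwt}(w^{2\mathfrak mk},s\to t)<\infty$ for some $k\ge1$, the pair $(s,t)$ is grounded. **Further letters.** The *cactus letter* $\alpha_{S',w}$ has, for each grounded pair $(s,r)$, a transition $s\to r$ of weight $\min_g\big(\mathrm{mwt}(w^{\mathfrak m},s\to g)+\mathrm{mwt}(w^{\mathfrak m},g\to r)\big)$ over $g\in\mathrm{MinStates}(S',w^{\mathfrak m})$. For a grounded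 pair $s=(q_1,p,T)$, $r=(q_2,p,T)$, the *rebase letter* $\beta_{S',w,s\to r}$ has a transition $(q',q_1,T)\to(q'',q_2,T)$ whose weight is that of $(q',p,T)\to(q'',p,T)$ on $\alpha_{S',w}$ minus that of $s\to r$. For $s=(q,p_1,T)$, $r=(q,p_2,T)$, the *jump letter* $\mathrm{jump}_{s\to r}$ takes $(q',p_1,T)$ to $(q',p_2,T)$ with weight $0$, for every $q'$. Standard and jump letters have depth $0$; $\alpha_{S',w}$ and $\beta_{S',w,s\to r}$ have depth $1+\mathrm{dep}(w)$; the depth of a word is the maximal depth of its letters ($0$ for the empty word). **Alphabets**, for $L:\mathbb N\to\mathbb N$. $\Gamma(L)$ is the least set containing all standard letters and every $\alpha_{S',w}$ with $w\in\Gamma(L)^*$, $(S',w)$ a non-degenerate stable cycle, $\mathrm{dep}(w)+1\le|S|-1$ and $|w|\le L(\mathrm{dep}(w)+1)$. $\Gamma_R(L)$ is $\Gamma(L)$ together with all $\beta_{S',w,s\to r}$, $\alpha_{S',w}\in\Gamma(L)$, $(s,r)$ grounded. $\Gamma_J(L)$ is $\Gamma_R(L)$ together with all jump letters. $\Gamma_{RC}(L)$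 consists of all $\alpha_{S',w}$ with $w\in\Gamma_R(L)^*$, $(S',w)$ a stable cycle and $|w|\le L(\mathrm{dep}(w)+1)$. **Length functions.** Let $W$ be the maximal absolute value of a finite transition weight on a standard letter, and let $R(k)$ be the least $R$ such that every $k$-colouring of the edges of $K_R$ has a monochromatic triangle. Fix $b\in\mathbb N$. Given $h\in\mathbb N$ and $i_0\in\{0,1\}$, define, by recursion on $d$ and downward recursion on $i$, $\mathrm{Len}(0,i)=1$, $\mathrm{MaxWt}(0)=W$, $\mathrm{Len}(d+1,|S|+1)=b$, $\mathrm{Cover}(d+1,|S|)=1$, and for $i\le|S|$ (with $i<|S|$ in the first line): $$\begin{aligned} \mathrm{Cover}(d+1,i)&=8\mathfrak m^2\big(\mathrm{MaxWt}(d)\,\mathrm{Len}(d,1)\,\mathrm{Len}(d+1,i+1)+\mathrm{Cover}(d+1,i+1)+h\big),\\ \mathrm{Types}(d+1,i)&=3^i\big(2\,\mathrm{Cover}(d+1,i)+2\big)^{2|S|i},\\ \mathrm{Amp}(d+1,i)&=32\mathfrak m^2\big(h+2\,\mathrm{MaxWt}(d)\big)\big(R(\mathrm{Types}(d+1,i))+\mathrm{Len}(d+1,i+1)+\mathrm{Len}(d,1)\big),\\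 \mathrm{Len}(d+1,i)&=32\mathfrak m^2\,\mathrm{Len}(d,1)\,\mathrm{Len}(d+1,i+1)\big(R(\mathrm{Types}(d+1,i))+2\big)^{2\mathrm{Amp}(d+1,i)+1},\\ \mathrm{MaxWt}(d+1)&=2\mathfrak m\,\mathrm{MaxWt}(d)\,\mathrm{Len}(d+1,i_0). \end{aligned}$$ Let $L_s(d)=\mathrm{Len}(d,1)$ for $h=0,\ i_0=1$; let $H=\mathrm{Amp}(|S|,0)$ for the same $h,i_0$; and let $L_g(d)=\mathrm{Len}(d,1)$ for $h=H,\ i_0=0$. **Configurations, potential, charge.** Let $c_w(s)=\mathrm{mwt}(w,s_0\to s)$ and let $\delta(s_0,w)$ be its support $\{s: c_w(s)<\infty\}$. Let $\delta_{\mathrm{ghost}}(s_0,w)=\{(p,q,T): p\in T,\ (p',q,T)\in\delta(s_0,w)\text{ for some }p'\}$. *$w$ has a seamless baseline run* if some run on $w$ from $s_0$ visits only baseline states and each of its prefixes has minimal weight among the runs from $s_0$, on the same prefix of $w$, to the same state. A state $q$ with $c(q)<\infty$ is *dominant* in a configuration $c$ if there are $z\in\Gamma_J(L_s)^*$ and $a\in\Gamma_{RC}(L_g)$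 such that there is a run on $za$ from $q$ but from no $p$ with $c(p)<c(q)$. For a jump-free $w$ with a seamless baseline run, the *potential* $\phi(w)$ is $\max\{c_w(q): q\text{ dominant in }c_w\}$. The *charge* is $\psi(w)=-\min_s c_w(s)$. The *maximal effect* $\mathrm{maxeff}(w)$ is the sum over the letters of $w$ of the maximal absolute value of a finite weight of a transition on that letter. **General separated repeating infixes.** A word $uxyv$ (given with its factorization) over $\Gamma(L_g)$ with a seamless baseline run is a *GSRI* if, with $G=4|S|\,\mathfrak m\,\mathrm{maxeff}(xy)+H$: 1. $\delta(s_0,u)=\delta(s_0,ux)=\delta(s_0,uxy)$ and $\mathfrak m\,|x|\le L_g(\mathrm{dep}(x)+1)$; 2. there are a partition of $\delta(s_0,u)$ into non-empty $V_1,\dots,V_\ell$ and integers $k_{j,x},k_{j,y}$ of equal sign ($-$, $0$ or $+$), $1\le j\le\ell$, such that $c_{ux}(s)=c_u(s)+k_{j,x}$ and $c_{uxy}(s)=c_{ux}(s)+k_{j,y}$ for all $s\in V_j$; and for $j<\ell$, $s\in V_j$, $s'\in V_{j+1}$ and each $c\in\{c_u,c_{ux},c_{uxy}\}$, $c(s)+G<c(s')$;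 3. $\psi(u)\ge\psi(ux)\ge\psi(uxy)$, and $\psi(u)=\psi(ux)$ if and only if $\psi(ux)=\psi(uxy)$. **Lemma.** Let $\mathcal A$ be such an automaton, let $b\in\mathbb N$, and let $uxyv$ be a GSRI (with $L_s$, $L_g$, $H$ formed with this $b$). Then either $(\delta_{\mathrm{ghost}}(s_0,u),x)$ is a stable cycle, or there is a word $w'$ over the standard letters whose potential $\phi(w')$ is defined and satisfies $\phi(w')\ge H$ (or both). -/

import Mathlib

noncomputable section

/-! ## Weighted automata over `(min,+)` -/

/-- A `(min,+)` weighted automaton with states `Q` and alphabet `Sg`: every triple `(p, σ, q)`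
carries exactly one weight in `ℤ ∪ {∞}` (weight `∞` = no transition); one initial state. -/
structure WFA (Q Sg : Type*) where
  init : Q
  wt : Q → Sg → Q → WithTop ℤ

/-- The transitions on one letter of an automaton with state space `S`, as a matrix of weights
(`⊤` = no transition). -/
abbrev WMat (S : Type*) := S → S → WithTop ℤ

section Runs

variable {S : Type*} [Fintype S] [DecidableEq S]

/-- The weight of the state sequence `s, ρ₁, ρ₂, …` on a word, the word being given as the list of
its letters' transition matrices. The sequence is a run iff this weight is not `⊤`. -/
def runWt : List (WMat S) → S → List S → WithTop ℤ
  | [], _, [] => 0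
  | M :: l, s, t :: ρ => M s t + runWt l t ρ
  | [], _, _ :: _ => ⊤
  | _ :: _, _, [] => ⊤

/-- `minWt l s r` is the minimal weight of a run from `s` to `r` on a word (`⊤` if there is none);
see `minWt_le_runWt` and `exists_runWt_eq_minWt`. -/
def minWt : List (WMat S) → WMat S
  | [], s, r => if s = r then 0 else ⊤
  | M :: l, s, r => Finset.univ.inf fun t => M s t + minWt l t r

theorem minWt_le_runWt (l : List (WMat S)) (s : S) (ρ : List S) :
    minWt l s ((s :: ρ).getLast (List.cons_ne_nil s ρ)) ≤ runWt l s ρ := by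
  induction l generalizing s ρ with
  | nil => cases ρ <;> simp [minWt, runWt]
  | cons M l ih =>
    cases ρ with
    | nil => simp [runWt]
    | cons t ρ =>
      simp only [minWt, runWt, List.getLast_cons_cons]
      exact (Finset.inf_le (Finset.mem_univ t)).trans (add_le_add le_rfl (ih t ρ))

theorem exists_runWt_eq_minWt (l : List (WMat S)) (s r : S) (h : minWt l s r ≠ ⊤) :
    ∃ ρ : List S, (s :: ρ).getLast (List.cons_ne_nil s ρ) = r ∧ runWt l s ρ = minWt l s r := by
  induction l generalizing s with
  | nil =>
    by_cases hs : s = r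
    · exact ⟨[], by simp [hs], by simp [minWt, runWt, hs]⟩
    · simp [minWt, hs] at h
  | cons M l ih =>
    obtain ⟨t, -, ht⟩ := Finset.exists_mem_eq_inf (Finset.univ : Finset S) ⟨s, Finset.mem_univ s⟩
      (fun t => M s t + minWt l t r)
    have e : minWt (M :: l) s r = M s t + minWt l t r := ht
    have h' : minWt l t r ≠ ⊤ := by
      intro h0
      rw [e, h0, add_top] at h
      exact h rfl
    obtain ⟨ρ, h1, h2⟩ := ih t h'
    exact ⟨t :: ρ, by rw [List.getLast_cons_cons]; exact h1, by rw [runWt, h2, e]⟩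

/-- The states of `S'` that have a cycle, where `P s r` is the minimal weight from `s` to `r`. -/
def refStates (S' : Finset S) (P : WMat S) : Finset S :=
  S'.filter fun s => P s s ≠ ⊤

/-- The states of `S'` whose cycle is of minimal weight among all cycles on states of `S'`. -/
def minStates (S' : Finset S) (P : WMat S) : Finset S :=
  (refStates S' P).filter fun s => ∀ r ∈ refStates S' P, P s s ≤ P r r

end Runs

/-! ## The baseline-augmented subset construction -/

/-- States `(inner, base, set)` of the baseline-augmented construction. -/
structure AState (Q : Type*) where
  inner : Q
  base : Q
  set : Finset Q
  inner_mem : inner ∈ set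
  base_mem : base ∈ set

namespace AState

variable {Q : Type*} [DecidableEq Q]

instance : DecidableEq (AState Q) := fun a b =>
  decidable_of_iff (a.inner = b.inner ∧ a.base = b.base ∧ a.set = b.set) (by
    cases a; cases b; simp)

instance [Fintype Q] : Fintype (AState Q) :=
  Fintype.ofEquiv {x : Q × Q × Finset Q // x.1 ∈ x.2.2 ∧ x.2.1 ∈ x.2.2}
    { toFun := fun x => ⟨x.1.1, x.1.2.1, x.1.2.2, x.2.1, x.2.2⟩
      invFun := fun s => ⟨(s.inner, s.base, s.set), s.inner_mem, s.base_mem⟩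
      left_inv := fun _ => rfl
      right_inv := fun _ => rfl }

/-- Baseline states: `(p, p, T)`. -/
def IsBaseline (s : AState Q) : Prop := s.inner = s.base

/-- The state with the inner state of `x` and the baseline component of `s`. -/
def rebaseTo (x s : AState Q) (h : x.set = s.set) : AState Q :=
  ⟨x.inner, s.base, x.set, x.inner_mem, h ▸ s.base_mem⟩

end AState

/-- The stabilisation constant `|S| * |S|!`, where `S` is the state space of the construction. -/
def stabConst (Q : Type*) [Fintype Q] [DecidableEq Q] : ℕ :=
  Fintype.card (AState Q) * (Fintype.card (AState Q)).factorial

/-- Letters: transitions `(p, σ, c, q)` of the automaton (the weight `c` is determined by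
`p, σ, q`), cactus letters `α_{S',w}`, rebase letters `β_{S',w,s→r}`, jump letters `jump_{s→r}`.
This is raw syntax; the alphabets below single out the legal letters. -/
inductive Letter (Q Sg : Type*) where
  | base (p : Q) (σ : Sg) (q : Q) : Letter Q Sg
  | cactus (S' : Finset (AState Q)) (w : List (Letter Q Sg)) : Letter Q Sg
  | rebase (S' : Finset (AState Q)) (w : List (Letter Q Sg)) (s r : AState Q) : Letter Q Sg
  | jump (s r : AState Q) : Letter Q Sg

namespace Letter

variable {Q Sg : Type*}

def IsBase : Letter Q Sg → Prop
  | base _ _ _ => True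
  | _ => False

def IsJump : Letter Q Sg → Prop
  | jump _ _ => True
  | _ => False

/-- Nesting depth of a letter. -/
def dep : Letter Q Sg → ℕ
  | base _ _ _ => 0
  | cactus _ w => 1 + (w.map dep).foldr max 0
  | rebase _ w _ _ => 1 + (w.map dep).foldr max 0
  | jump _ _ => 0

/-- Depth of a word: the maximal depth of its letters (`0` for the empty word). -/
def wordDep (w : List (Letter Q Sg)) : ℕ := (w.map dep).foldr max 0

end Letter

/-- The word `w ^ n`. -/
def wordPow {X : Type*} (w : List X) (n : ℕ) : List X := (List.replicate n w).flatten

section LetterWeights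

variable {Q : Type*} [Fintype Q] [DecidableEq Q]

/-- Transitions on `α_{S',w}` (with `w` given by its letters' matrices). From `s ∈ S'` to `r ∈ S'`
the weight is `mwt(s → w^𝔪 → g → w^𝔪 → r)` for the best `g` in `MinStates(S', w^𝔪)`; it is `⊤` iff
`(s, r)` is not a grounded pair. -/
def cactusWt (S' : Finset (AState Q)) (l : List (WMat (AState Q))) : WMat (AState Q) :=
  fun s r =>
    if s ∈ S' ∧ r ∈ S' then
      (minStates S' (minWt (wordPow l (stabConst Q)))).inf fun g =>
        minWt (wordPow l (stabConst Q)) s g + minWt (wordPow l (stabConst Q)) g r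
    else ⊤

/-- `a - c` for a finite `c` (and `⊤` for `c = ⊤`). -/
def subWt (a : WithTop ℤ) : WithTop ℤ → WithTop ℤ
  | ⊤ => ⊤
  | (c : ℤ) => a + ((-c : ℤ) : WithTop ℤ)

/-- Transitions on `β_{S',w,s→r}`, where `M` holds the transitions on `α_{S',w}`,
`s = (q₁, p, T)` and `r = (q₂, p, T)`: from `(q', q₁, T)` to `(q'', q₂, T)` the weight is that of
`α_{S',w}` from `(q', p, T)` to `(q'', p, T)` minus the one from `s` to `r`. -/
def rebaseWt (M : WMat (AState Q)) (s r : AState Q) : WMat (AState Q) := fun x y =>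
  if h : x.set = s.set ∧ y.set = r.set ∧ x.base = s.inner ∧ y.base = r.inner then
    subWt (M (x.rebaseTo s h.1) (y.rebaseTo r h.2.1)) (M s r)
  else ⊤

/-- Transitions on `jump_{s→r}`: change the baseline component from that of `s` to that of `r`. -/
def jumpWt (s r : AState Q) : WMat (AState Q) := fun x y =>
  if x.inner = y.inner ∧ x.base = s.base ∧ x.set = s.set ∧ y.base = r.base ∧ y.set = r.set
  then 0 else ⊤

end LetterWeights

namespace WFA

variable {Q Sg : Type*} [Fintype Q] [DecidableEq Q] (A : WFA Q Sg)

/-- The states of `A` reachable from `T` by reading `σ`. -/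
def reach (T : Finset Q) (σ : Sg) : Finset Q :=
  Finset.univ.filter fun q => ∃ p ∈ T, A.wt p σ q ≠ ⊤

/-- Transitions of the baseline-augmented construction on the letter `(p, σ, c, q)`. -/
def baseWt (p : Q) (σ : Sg) (q : Q) : WMat (AState Q) := fun x y =>
  if x.base = p ∧ y.base = q ∧ y.set = A.reach x.set σ then
    subWt (A.wt x.inner σ y.inner) (A.wt p σ q)
  else ⊤

/-- Transitions on an arbitrary letter. -/
def letterWt : Letter Q Sg → WMat (AState Q)
  | .base p σ q => A.baseWt p σ q
  | .cactus S' w => cactusWt S' (w.map letterWt)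
  | .rebase S' w s r => rebaseWt (cactusWt S' (w.map letterWt)) s r
  | .jump s r => jumpWt s r

/-- `mwt w s r`: the minimal weight of a run on the word `w` from `s` to `r`. -/
def mwt (w : List (Letter Q Sg)) : WMat (AState Q) := minWt (w.map A.letterWt)

/-- The initial state `(q₀, q₀, {q₀})`. -/
def s0 : AState Q :=
  ⟨A.init, A.init, {A.init}, Finset.mem_singleton_self _, Finset.mem_singleton_self _⟩

/-- The configuration reached from the initial state by reading `w`. -/
def xconf (w : List (Letter Q Sg)) : AState Q → WithTop ℤ := A.mwt w A.s0

/-- The states reachable from the initial state by reading `w` (the support of `xconf w`). -/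
def reachable (w : List (Letter Q Sg)) : Finset (AState Q) :=
  Finset.univ.filter fun s => A.xconf w s ≠ ⊤

/-- The ghost-reachable states: if the reachable states after `w` are `{(p, q, T) | p ∈ T'}`, these
are `{(p, q, T) | p ∈ T}`. -/
def ghost (w : List (Letter Q Sg)) : Finset (AState Q) :=
  Finset.univ.filter fun s => ∃ r ∈ A.reachable w, s.base = r.base ∧ s.set = r.set

/-- The baseline run on `w` from the initial state exists and is seamless: there is a run on `w`
that visits only baseline states and whose every prefix has the minimal weight among all runs from
the initial state, on the same prefix of `w`, to the same state. -/
def HasSeamlessBaselineRun (w : List (Letter Q Sg)) : Prop :=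
  ∃ ρ : List (AState Q), ρ.length = w.length ∧ (∀ s ∈ ρ, s.IsBaseline) ∧
    ∀ i ≤ w.length,
      runWt ((w.take i).map A.letterWt) A.s0 (ρ.take i) ≠ ⊤ ∧
      runWt ((w.take i).map A.letterWt) A.s0 (ρ.take i) =
        A.xconf (w.take i) ((A.s0 :: ρ.take i).getLast (List.cons_ne_nil _ _))

/-! ### Cycles -/

/-- `S' = {(p, q, T) | p ∈ T}`. -/
def IsFullSet (S' : Finset (AState Q)) (q : Q) (T : Finset Q) : Prop :=
  ∀ s : AState Q, s ∈ S' ↔ s.base = q ∧ s.set = T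

/-- `(S', w)` is a reflexive cycle: `S' = {(p, q, T) | p ∈ T}` and reading `w` from `S'` leads
back into `S'`. -/
def IsReflexiveCycle (S' : Finset (AState Q)) (w : List (Letter Q Sg)) : Prop :=
  (∃ q T, IsFullSet S' q T) ∧ ∀ s ∈ S', ∀ r, A.mwt w s r ≠ ⊤ → r ∈ S'

/-- `(S', w)` is a stable cycle: a reflexive cycle such that, for every `n`, the baseline state of
`S'` is minimal reflexive for `w ^ n`, with a cycle of minimal weight `0`. -/
def IsStableCycle (S' : Finset (AState Q)) (w : List (Letter Q Sg)) : Prop :=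
  A.IsReflexiveCycle S' w ∧ ∃ s ∈ S', s.IsBaseline ∧
    ∀ n : ℕ, s ∈ minStates S' (A.mwt (wordPow w n)) ∧ A.mwt (wordPow w n) s s = 0

/-- `(s, r)` is a grounded pair of `(S', w)`. -/
def IsGrounded (S' : Finset (AState Q)) (w : List (Letter Q Sg)) (s r : AState Q) : Prop :=
  s ∈ S' ∧ r ∈ S' ∧ ∃ g ∈ minStates S' (A.mwt (wordPow w (stabConst Q))),
    A.mwt (wordPow w (stabConst Q)) s g ≠ ⊤ ∧ A.mwt (wordPow w (stabConst Q)) g r ≠ ⊤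

/-- `(S', w)` is degenerate. -/
def IsDegenerate (S' : Finset (AState Q)) (w : List (Letter Q Sg)) : Prop :=
  ∀ s ∈ S', ∀ t ∈ refStates S' (A.mwt (wordPow w (2 * stabConst Q))),
    (∃ k : ℕ, 1 ≤ k ∧ A.mwt (wordPow w (2 * stabConst Q * k)) s t ≠ ⊤) → A.IsGrounded S' w s t

/-! ### Effective alphabets, for a length bound `L` -/

/-- Bounded cactus letters: standard letters, and cactus letters `α_{S',w}` of depth
`d = dep w + 1 ≤ |S| - 1` over non-degenerate stable cycles, with `|w| ≤ L d` and `w` itself built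
from bounded cactus letters. -/
inductive IsCac (L : ℕ → ℕ) : Letter Q Sg → Prop
  | base (p : Q) (σ : Sg) (q : Q) : IsCac L (.base p σ q)
  | cactus (S' : Finset (AState Q)) (w : List (Letter Q Sg)) (letters : ∀ a ∈ w, IsCac L a)
      (stable : A.IsStableCycle S' w) (nondeg : ¬ A.IsDegenerate S' w)
      (depth : Letter.wordDep w + 1 ≤ Fintype.card (AState Q) - 1)
      (len : w.length ≤ L (Letter.wordDep w + 1)) : IsCac L (.cactus S' w)

/-- Bounded cactus letters and their rebase letters. -/
inductive IsCacReb (L : ℕ → ℕ) : Letter Q Sg → Prop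
  | cac (a : Letter Q Sg) (ha : A.IsCac L a) : IsCacReb L a
  | rebase (S' : Finset (AState Q)) (w : List (Letter Q Sg)) (s r : AState Q)
      (ha : A.IsCac L (.cactus S' w)) (hg : A.IsGrounded S' w s r) :
      IsCacReb L (.rebase S' w s r)

/-- Cactus letters obtained by one stabilisation of a word over `IsCacReb L`. -/
inductive IsCacRebCac (L : ℕ → ℕ) : Letter Q Sg → Prop
  | cactus (S' : Finset (AState Q)) (w : List (Letter Q Sg)) (letters : ∀ a ∈ w, A.IsCacReb L a)
      (stable : A.IsStableCycle S' w) (len : w.length ≤ L (Letter.wordDep w + 1)) :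
      IsCacRebCac L (.cactus S' w)

/-- `IsCacReb L` together with all jump letters `jump_{s→r}`, `s = (q, p₁, T)`, `r = (q, p₂, T)`. -/
inductive IsCacRebJump (L : ℕ → ℕ) : Letter Q Sg → Prop
  | cacReb (a : Letter Q Sg) (ha : A.IsCacReb L a) : IsCacRebJump L a
  | jump (s r : AState Q) (hq : s.inner = r.inner) (hT : s.set = r.set) :
      IsCacRebJump L (.jump s r)

/-! ### Maximal weights -/

/-- The maximal absolute value of a finite weight of a transition on the letter `a` (`0` if there
is none). -/
def wmax (a : Letter Q Sg) : ℕ :=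
  Finset.univ.sup fun e : AState Q × AState Q => ((A.letterWt a e.1 e.2).untopD 0).natAbs

/-- The maximal effect of a word. -/
def maxeff (w : List (Letter Q Sg)) : ℕ := (w.map A.wmax).sum

/-- The maximal weight of a transition on a standard letter. -/
def maxBaseWt [Fintype Sg] : ℕ :=
  Finset.univ.sup fun e : Q × Sg × Q => A.wmax (.base e.1 e.2.1 e.2.2)

end WFA

/-! ## The recursive length functions -/

/-- `ramsey k n` is the least `R` such that every colouring of the two-element subsets of an
`R`-element set with `k` colours is constant on the two-element subsets of some set of size at
least `n`. -/
def ramsey (k n : ℕ) : ℕ :=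
  sInf {R : ℕ | ∀ c : {e : Sym2 (Fin R) // ¬ e.IsDiag} → Fin k,
    ∃ T : Finset (Fin R), n ≤ T.card ∧
      ∀ e e' : {e : Sym2 (Fin R) // ¬ e.IsDiag},
        (∀ i ∈ e.1, i ∈ T) → (∀ i ∈ e'.1, i ∈ T) → c e = c e'}

/-- Data for the recursive functions. `n = |S|`, `m` is the stabilisation constant, `w0` the maximal
weight of a standard letter and `b` the base value `Len (d, |S| + 1)`. The simple functions have
`h = 0` and `i0 = 1`; the general ones have `h = H` and `i0 = 0`, where `i0` is the index in
`MaxWt (d + 1) = 2 m MaxWt d * Len (d + 1, i0)`. -/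
structure LenData where
  n : ℕ
  m : ℕ
  w0 : ℕ
  b : ℕ
  h : ℕ
  i0 : ℕ

namespace LenData

variable (D : LenData)

/-- `Types (d + 1, i) = 3 ^ i (2 Cover (d + 1, i) + 2) ^ (2 |S| i)`, given the cover value. -/
def typesOf (i cover : ℕ) : ℕ := 3 ^ i * (2 * cover + 2) ^ (2 * D.n * i)

/-- `Amp (d + 1, i)`, given `Len (d, 1)`, `MaxWt d`, `Len (d + 1, i + 1)`, `Types (d + 1, i)`. -/
def ampOf (len1 maxW lenNext types : ℕ) : ℕ :=
  32 * D.m ^ 2 * (D.h + 2 * maxW) * (ramsey types 3 + lenNext + len1)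

/-- With `len1 = Len (d, 1)` and `maxW = MaxWt d`, the value at `j` is the pair
`(Len (d + 1, i), Cover (d + 1, i))` for `i = |S| + 1 - j`. (`Cover` starts at `i = |S|`; its entry
at `j = 0` is never used.) -/
def level (len1 maxW : ℕ) : ℕ → ℕ × ℕ
  | 0 => (D.b, 0)
  | j + 1 =>
    let lenNext := (level len1 maxW j).1
    let cover :=
      if j = 0 then 1
      else 8 * D.m ^ 2 * (maxW * len1 * lenNext + (level len1 maxW j).2 + D.h)
    let types := D.typesOf (D.n - j) cover
    (32 * D.m ^ 2 * len1 * lenNext *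
      (ramsey types 3 + 2) ^ (2 * D.ampOf len1 maxW lenNext types + 1), cover)

/-- The pair `(Len (d, 1), MaxWt d)`. -/
def depthVals : ℕ → ℕ × ℕ
  | 0 => (1, D.w0)
  | d + 1 =>
    let v := depthVals d
    ((D.level v.1 v.2 D.n).1, 2 * D.m * v.2 * (D.level v.1 v.2 (D.n + 1 - D.i0)).1)

/-- The length bound `L d = Len (d, 1)`. -/
def lenBound (d : ℕ) : ℕ := (D.depthVals d).1

/-- `Len (d, i)`, for `i ≤ |S| + 1`. -/
def len : ℕ → ℕ → ℕ
  | 0, _ => 1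
  | d + 1, i => (D.level (D.depthVals d).1 (D.depthVals d).2 (D.n + 1 - i)).1

/-- `Cover (d + 1, i)`, for `i ≤ |S|`. -/
def coverSucc (d i : ℕ) : ℕ := (D.level (D.depthVals d).1 (D.depthVals d).2 (D.n + 1 - i)).2

/-- `Amp (d + 1, i)`, for `i ≤ |S|`. -/
def ampSucc (d i : ℕ) : ℕ :=
  D.ampOf (D.depthVals d).1 (D.depthVals d).2 (D.len (d + 1) (i + 1))
    (D.typesOf i (D.coverSucc d i))

end LenData

namespace WFA

variable {Q Sg : Type*} [Fintype Q] [DecidableEq Q] [Fintype Sg] (A : WFA Q Sg)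

/-- Data of the simple functions. -/
def simpData (b : ℕ) : LenData :=
  { n := Fintype.card (AState Q), m := stabConst Q, w0 := A.maxBaseWt, b := b, h := 0, i0 := 1 }

/-- The simple length bound. -/
def Lsimp (b : ℕ) : ℕ → ℕ := (A.simpData b).lenBound

/-- The constant `H = Amp (|S|, 0)` (simple functions; `|S| ≥ 1`). -/
def H (b : ℕ) : ℕ := (A.simpData b).ampSucc (Fintype.card (AState Q) - 1) 0

/-- Data of the general functions. -/
def genData (b : ℕ) : LenData :=
  { n := Fintype.card (AState Q), m := stabConst Q, w0 := A.maxBaseWt, b := b, h := A.H b, i0 := 0 }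

/-- The general length bound. -/
def Lgen (b : ℕ) : ℕ → ℕ := (A.genData b).lenBound

/-! ### Dominance, potential and charge -/

/-- The (reached) state `q` is dominant in the configuration `c`: some suffix, a word over the
simple alphabet with rebase and jump letters followed by one general cactus letter, has a run from
`q` but from no state with a lower value. -/
def IsDominant (b : ℕ) (c : AState Q → WithTop ℤ) (q : AState Q) : Prop :=
  c q ≠ ⊤ ∧ ∃ (z : List (Letter Q Sg)) (a : Letter Q Sg),
    (∀ e ∈ z, A.IsCacRebJump (A.Lsimp b) e) ∧ A.IsCacRebCac (A.Lgen b) a ∧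
    (∃ r, A.mwt (z ++ [a]) q r ≠ ⊤) ∧ ∀ p, c p < c q → ∀ r, A.mwt (z ++ [a]) p r = ⊤

/-- The potential of `w` is defined and equals `z`: `w` is jump-free with a seamless baseline run,
and `z` is the maximal value of a dominant state in the configuration reached by `w`. -/
def IsPotential (b : ℕ) (w : List (Letter Q Sg)) (z : ℤ) : Prop :=
  (∀ a ∈ w, ¬ a.IsJump) ∧ A.HasSeamlessBaselineRun w ∧
    IsGreatest {y : ℤ | ∃ q, A.IsDominant b (A.xconf w) q ∧ A.xconf w q = y} z

/-- The charge of `w`: minus the minimal value in the configuration reached by `w`. (This minimum is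
finite whenever `w` has a baseline run; the charge is used only for such words.) -/
def charge (w : List (Letter Q Sg)) : ℤ := -((Finset.univ.inf (A.xconf w)).untopD 0)

/-! ### Separated repeating infixes -/

/-- `u x y v` is a separated repeating infix for the length bound `L` and the gap `G`. -/
structure IsSRI (L : ℕ → ℕ) (G : ℕ) (u x y v : List (Letter Q Sg)) : Prop where
  letters : ∀ a ∈ u ++ x ++ y ++ v, A.IsCac L a
  supp_x : A.reachable (u ++ x) = A.reachable u
  supp_xy : A.reachable (u ++ x ++ y) = A.reachable u
  len_x : stabConst Q * x.length ≤ L (Letter.wordDep x + 1)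
  /-- The reachable states are partitioned into non-empty `V 0, …, V (ℓ - 1)`. -/
  partition : ∃ (ℓ : ℕ) (V : Fin ℓ → Finset (AState Q)) (kx ky : Fin ℓ → ℤ),
    (∀ j, (V j).Nonempty) ∧ (∀ i j, i ≠ j → Disjoint (V i) (V j)) ∧
    (∀ s, s ∈ A.reachable u ↔ ∃ j, s ∈ V j) ∧
    (∀ i j : Fin ℓ, (i : ℕ) + 1 = j → ∀ s ∈ V i, ∀ s' ∈ V j,
      A.xconf u s + (G : ℤ) < A.xconf u s' ∧
      A.xconf (u ++ x) s + (G : ℤ) < A.xconf (u ++ x) s' ∧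
      A.xconf (u ++ x ++ y) s + (G : ℤ) < A.xconf (u ++ x ++ y) s') ∧
    (∀ j, ∀ s ∈ V j, A.xconf (u ++ x) s = A.xconf u s + kx j ∧
      A.xconf (u ++ x ++ y) s = A.xconf (u ++ x) s + ky j) ∧
    ∀ j, (kx j).sign = (ky j).sign
  baseline : A.HasSeamlessBaselineRun (u ++ x ++ y ++ v)

/-- `u x y v` is a general separated repeating infix. -/
structure IsGSRI (b : ℕ) (u x y v : List (Letter Q Sg)) : Prop where
  sri : A.IsSRI (A.Lgen b)
    (4 * Fintype.card (AState Q) * stabConst Q * A.maxeff (x ++ y) + A.H b) u x y v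
  charge_x : A.charge (u ++ x) ≤ A.charge u
  charge_xy : A.charge (u ++ x ++ y) ≤ A.charge (u ++ x)
  charge_iff : A.charge u = A.charge (u ++ x) ↔ A.charge (u ++ x) = A.charge (u ++ x ++ y)

end WFA

end

/-! Reading `x` maps the class of ghost states (fixed base and set component) into itself, and its
baseline loop has weight at most 0. If no power of `x` has a negative cycle on that class, the
baseline loop is therefore minimal and the cycle is stable (`isStableCycle_of_nonneg`).

Otherwise take a cycle of minimal mean: `x^n` at a ghost state `r`, of weight `W < 0`, with `n ≤
|S|` (`exists_min_mean_cycle`). Making this loop the baseline of `x^n` subtracts `W` per round, so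
every cycle becomes nonnegative and the rebased word `x'` is a stable cycle. Its cactus letter is
legal because condition 1 bounds `𝔪 |x|` and `n ≤ 𝔪` (`exists_stable_rebase`).

The lowest class of reached states cannot use that letter. Since the charge does not grow along `x`,
the shift of this class is nonnegative; since the gap above it is at least the maximal effect of
`x`, runs on powers of `x` cannot leave it, and cycles inside it are nonnegative (`closed_of_gap`).
Being grounded in `x'` would lead such a state to a negative cycle of `x`.

To convert this into potential, the cactus letters of `u` are unfolded into high powers
(`IsCac.flattenable`): finite values persist, and the ghost states that were unreached acquire
values at least `H` above the minimum. Rebasing the flat word along an optimal run to a minimal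
state `f` makes values relative to `f` and the baseline run seamless (`exists_rebase_word`,
`hasSeamlessBaselineRun_of_mwt`). A jump to the baseline of `x'` followed by its cactus letter is
then readable from the copy of `r`; the lowest state from which it is readable is dominant
(`exists_isDominant`), and it lies outside the lowest class, hence at height at least `H`. -/

section Powers

/-! ### Walks and cycles in the powers of a min-plus matrix -/

variable {S : Type*}

/-- The laws of the powers of a `(min,+)` matrix. -/
structure MinPlusPowers (P : ℕ → WMat S) : Prop where
  zero_self : ∀ s, P 0 s s = 0
  eq_of_zero : ∀ s r, P 0 s r ≠ ⊤ → s = r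
  add_le : ∀ a b s t r, P (a + b) s r ≤ P a s t + P b t r
  exists_split : ∀ a b s r, ∃ t, P (a + b) s r = P a s t + P b t r

namespace MinPlusPowers

variable {P : ℕ → WMat S}

theorem add_le_of_le (h : MinPlusPowers P) {a b n : ℕ} (hn : a + b = n) {s t r : S} {x y : ℤ}
    (hx : P a s t ≤ x) (hy : P b t r ≤ y) : P n s r ≤ ((x + y : ℤ) : WithTop ℤ) := by
  subst hn
  refine (h.add_le a b s t r).trans ?_
  rw [WithTop.coe_add]
  exact add_le_add hx hy

/-- An optimal walk, as a sequence of states `ρ` with accumulated weights `f`. -/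
theorem exists_walk (h : MinPlusPowers P) (N : ℕ) (s r : S) (hN : P N s r ≠ ⊤) :
    ∃ (ρ : ℕ → S) (f : ℕ → ℤ), ρ 0 = s ∧ ρ N = r ∧ f 0 = 0 ∧ P N s r = (f N : ℤ) ∧
      ∀ i j, i ≤ j → j ≤ N → P (j - i) (ρ i) (ρ j) ≤ ((f j - f i : ℤ) : WithTop ℤ) := by
  induction N generalizing r with
  | zero =>
    obtain rfl := h.eq_of_zero _ _ hN
    refine ⟨fun _ => s, fun _ => 0, rfl, rfl, rfl, by simp [h.zero_self], ?_⟩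
    intro i j _ hj
    obtain rfl : j = 0 := by omega
    simp [h.zero_self]
  | succ N ih =>
    obtain ⟨t, ht⟩ := h.exists_split N 1 s r
    have h1 : P N s t ≠ ⊤ := fun e => hN (by rw [ht, e, top_add])
    have h2 : P 1 t r ≠ ⊤ := fun e => hN (by rw [ht, e, add_top])
    obtain ⟨c, hc⟩ := WithTop.ne_top_iff_exists.mp h2
    obtain ⟨ρ, f, h0, hN', hf0, hfN, hle⟩ := ih t h1
    refine ⟨fun i => if i ≤ N then ρ i else r, fun i => if i ≤ N then f i else f N + c,
      by simp [h0], by simp, by simp [hf0], ?_, ?_⟩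
    · rw [ht, hfN, ← hc]; simp
    · intro i j hij hj
      by_cases hjN : j ≤ N
      · have hiN : i ≤ N := hij.trans hjN
        simpa only [hjN, hiN, if_true] using hle i j hij hjN
      · obtain rfl : j = N + 1 := by omega
        by_cases hiN : i ≤ N
        · simp only [hiN, if_true, hjN, if_false]
          have := h.add_le_of_le (n := N + 1 - i) (a := N - i) (b := 1) (by omega) (hle i N hiN le_rfl)
            (y := c) (r := r) (by rw [hN', hc])
          convert this using 2
          ring
        · obtain rfl : i = N + 1 := by omega
          simp [h.zero_self]

theorem mul_self_le (h : MinPlusPowers P) {c : ℕ} {v : S} {x : ℤ} (hv : P c v v ≤ x) (e : ℕ) :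
    P (c * e) v v ≤ ((e * x : ℤ) : WithTop ℤ) := by
  induction e with
  | zero => simp [h.zero_self]
  | succ e ih =>
    have := h.add_le_of_le (n := c * (e + 1)) (by ring) ih hv
    convert this using 2
    push_cast; ring

variable [Fintype S] (S' : Finset S)

/-- The states of `S'` only lead to states of `S'`. -/
def Closed (S' : Finset S) (P : ℕ → WMat S) : Prop :=
  ∀ n, ∀ s ∈ S', ∀ r, P n s r ≠ ⊤ → r ∈ S'

variable {S'}

theorem ne_top_of_le_coe {x : WithTop ℤ} {z : ℤ} (h : x ≤ z) : x ≠ ⊤ :=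
  ne_top_of_le_ne_top WithTop.coe_ne_top h

/-- Without negative cycles, walks can be shortened below `|S| * c`, keeping the length modulo
`c`. -/
theorem exists_shorter (h : MinPlusPowers P) (hcl : Closed S' P)
    (hnn : ∀ n, ∀ s ∈ S', 0 ≤ P n s s) {s r : S} (hs : s ∈ S') {c : ℕ} (hc : 1 ≤ c) (N : ℕ)
    {z : ℤ} (hN : P N s r ≤ z) :
    ∃ N', N' < Fintype.card S * c ∧ N' ≡ N [MOD c] ∧ P N' s r ≤ z := by
  induction N using Nat.strong_induction_on with
  | _ N ih =>
    by_cases hlt : N < Fintype.card S * c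
    · exact ⟨N, hlt, rfl, hN⟩
    obtain ⟨ρ, f, h0, hr, hf0, hfN, hle⟩ := h.exists_walk N s r (ne_top_of_le_coe hN)
    have : NeZero c := ⟨by omega⟩
    -- Pigeonhole on pairs (state, index mod `c`). Cutting out the loop between two equal pairs
    -- keeps the length mod `c`, and does not raise the weight because the loop is nonnegative.
    obtain ⟨i, j, hij, he⟩ := Fintype.exists_ne_map_eq_of_card_lt
      (fun i : Fin (N + 1) => (ρ i, Fin.ofNat c i)) (by
        simp only [Fintype.card_fin, Fintype.card_prod]; omega)
    wlog hlt' : i < j generalizing i j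
    · exact this j i hij.symm he.symm (lt_of_le_of_ne (not_lt.mp hlt') hij.symm)
    have he1 : ρ i = ρ j := (Prod.ext_iff.mp he).1
    have he2 : (i : ℕ) % c = j % c := by
      have := congrArg Fin.val (Prod.ext_iff.mp he).2
      simpa [Fin.ofNat] using this
    have hi := i.2
    have hj := j.2
    have hij' : (i : ℕ) < j := hlt'
    have h1 := hle 0 i (by omega) (by omega)
    have h2 := hle i j (by omega) (by omega)
    have h3 := hle j N (by omega) (by omega)
    rw [h0, Nat.sub_zero] at h1
    rw [hr] at h3
    have hmem : ρ i ∈ S' := hcl _ _ hs _ (ne_top_of_le_coe h1)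
    rw [← he1] at h2 h3
    have hpos : 0 ≤ f j - f i := by exact_mod_cast (hnn _ _ hmem).trans h2
    have h4 := h.add_le_of_le (n := i + (N - j)) rfl h1 h3
    have hz : f N ≤ z := by rw [hfN] at hN; exact_mod_cast hN
    obtain ⟨N', hN1, hN2, hN3⟩ := ih (i + (N - j)) (by omega)
      (h4.trans (by exact_mod_cast (by linarith)))
    refine ⟨N', hN1, hN2.trans ?_, hN3⟩
    have e2 : (i : ℕ) + (N - j) ≡ j + (N - j) [MOD c] := Nat.ModEq.add_right _ he2
    rwa [show (j : ℕ) + (N - j) = N by omega] at e2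

/-- A closed walk longer than `|S|` splits into two shorter closed walks. -/
theorem exists_split_cycle (h : MinPlusPowers P) (hcl : Closed S' P) {v : S} (hv : v ∈ S') {c : ℕ}
    (hc : Fintype.card S < c) {z : ℤ} (hz : P c v v ≤ z) :
    ∃ a b x y, ∃ t ∈ S', a + b = c ∧ 1 ≤ a ∧ 1 ≤ b ∧ x + y = z ∧ P a v v ≤ (x : ℤ) ∧
      P b t t ≤ (y : ℤ) := by
  obtain ⟨ρ, f, h0, hr, hf0, hfN, hle⟩ := h.exists_walk c v v (ne_top_of_le_coe hz)
  -- Only the positions `0, …, c - 1` are used: with the final position included, the repetition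
  -- could be the whole walk and the remainder empty.
  obtain ⟨i, j, hij, he⟩ := Fintype.exists_ne_map_eq_of_card_lt
    (fun i : Fin c => ρ i) (by simpa using hc)
  wlog hlt' : i < j generalizing i j
  · exact this j i hij.symm he.symm (lt_of_le_of_ne (not_lt.mp hlt') hij.symm)
  have he1 : ρ i = ρ j := he
  have hi := i.2
  have hj := j.2
  have hij' : (i : ℕ) < j := hlt'
  have h1 := hle 0 i (by omega) (by omega)
  have h2 := hle i j (by omega) (by omega)
  have h3 := hle j c (by omega) (by omega)
  rw [h0, Nat.sub_zero] at h1
  rw [hr] at h3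
  have hmem : ρ i ∈ S' := hcl _ _ hv _ (ne_top_of_le_coe h1)
  rw [← he1] at h2 h3
  have hz' : f c ≤ z := by rw [hfN] at hz; exact_mod_cast hz
  have h4 := h.add_le_of_le (n := i + (c - j)) rfl h1 h3
  refine ⟨i + (c - j), j - i, z - (f j - f i), f j - f i, ρ i, hmem, by omega, by omega, by omega,
    by ring, h4.trans ?_, h2⟩
  exact_mod_cast (by linarith)

/-- A longer closed walk splits into two; the piece at `t` is nonnegative, so the shorter piece at
`v` is still nonpositive. -/
theorem exists_short_zero_cycle (h : MinPlusPowers P) (hcl : Closed S' P)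
    (hnn : ∀ n, ∀ s ∈ S', 0 ≤ P n s s) {v : S} (hv : v ∈ S') {c : ℕ} (hc : 1 ≤ c)
    (hz : P c v v ≤ 0) : ∃ c', 1 ≤ c' ∧ c' ≤ Fintype.card S ∧ P c' v v ≤ 0 := by
  induction c using Nat.strong_induction_on with
  | _ c ih =>
    by_cases hle : c ≤ Fintype.card S
    · exact ⟨c, hc, hle, hz⟩
    obtain ⟨a, b, x, y, t, ht, hab, ha, hb, hxy, hx, hy⟩ :=
      h.exists_split_cycle hcl hv (not_le.mp hle) (z := 0) (by simpa using hz)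
    have hy0 : 0 ≤ y := by exact_mod_cast (hnn _ _ ht).trans hy
    exact ih a (by omega) ha (hx.trans (by exact_mod_cast (by omega)))

/-- A bound on the means of the short cycles bounds the means of all cycles. -/
theorem mean_le_of_short (h : MinPlusPowers P) (hcl : Closed S' P) {n : ℕ} {W : ℤ}
    (hW : ∀ v ∈ S', ∀ k, 1 ≤ k → k ≤ Fintype.card S → ∀ z : ℤ, P k v v ≤ z → k * W ≤ n * z)
    {v : S} (hv : v ∈ S') (k : ℕ) (hk : 1 ≤ k) (z : ℤ) (hz : P k v v ≤ z) : k * W ≤ n * z := by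
  induction k using Nat.strong_induction_on generalizing v z with
  | _ k ih =>
    by_cases hle : k ≤ Fintype.card S
    · exact hW v hv k hk hle z hz
    obtain ⟨a, b, x, y, t, ht, hab, ha, hb, hxy, hx, hy⟩ :=
      h.exists_split_cycle hcl hv (not_le.mp hle) hz
    have h1 := ih a (by omega) hv ha x hx
    have h2 := ih b (by omega) ht hb y hy
    rw [← hab, ← hxy]
    push_cast
    linarith

/-- If there is a negative cycle, then there is a negative cycle of minimal mean and length at most
`|S|`. -/
theorem exists_min_mean_cycle (h : MinPlusPowers P) (hcl : Closed S' P) {v : S} (hv : v ∈ S')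
    {k : ℕ} (hneg : P k v v < 0) :
    ∃ r ∈ S', ∃ (n : ℕ) (W : ℤ), 1 ≤ n ∧ n ≤ Fintype.card S ∧ P n r r = W ∧ W < 0 ∧
      ∀ t ∈ S', ∀ j, ∀ z : ℤ, P j t t ≤ z → j * W ≤ n * z := by
  classical
  have hk : 1 ≤ k := by
    rcases Nat.eq_zero_or_pos k with rfl | hk
    · rw [h.zero_self] at hneg; exact absurd hneg (lt_irrefl _)
    · exact hk
  obtain ⟨zk, hzk⟩ := WithTop.ne_top_iff_exists.mp (ne_top_of_lt hneg)
  have hzk0 : zk < 0 := by rw [← hzk] at hneg; exact_mod_cast hneg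
  let E : Finset (S × ℕ) := (S' ×ˢ Finset.Icc 1 (Fintype.card S)).filter
    fun e => P e.2 e.1 e.1 ≠ ⊤
  have hE : E.Nonempty := by
    by_contra hne
    rw [Finset.not_nonempty_iff_eq_empty] at hne
    -- Without finite short cycles the hypothesis is vacuous, and the choice `n = 1`, `W = 0` would
    -- force `zk` to be nonnegative.
    have := h.mean_le_of_short hcl (n := 1) (W := 0) (by
      intro t ht j h1 h2 z hz
      have : (t, j) ∈ E := by simp [E, ht, h1, h2, ne_top_of_le_coe hz]
      simp [hne] at this) hv k hk zk hzk.ge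
    simp at this; omega
  obtain ⟨⟨r, n⟩, hm, hmin⟩ := Finset.exists_min_image E
    (fun e => (((P e.2 e.1 e.1).untopD (0 : ℤ) : ℤ) : ℚ) / e.2) hE
  simp only [E, Finset.mem_filter, Finset.mem_product, Finset.mem_Icc] at hm
  obtain ⟨⟨hr, hn1, hn2⟩, hfin⟩ := hm
  obtain ⟨W, hW⟩ := WithTop.ne_top_iff_exists.mp hfin
  have hall : ∀ t ∈ S', ∀ j, 1 ≤ j → ∀ z : ℤ, P j t t ≤ z → j * W ≤ n * z := by
    intro t ht j hj z hz
    refine h.mean_le_of_short hcl ?_ ht j hj z hz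
    intro t ht j h1 h2 z hz
    obtain ⟨z', hz'⟩ := WithTop.ne_top_iff_exists.mp (ne_top_of_le_coe hz)
    have := hmin (t, j) (by simp [E, ht, h1, h2, ne_top_of_le_coe hz])
    simp only [← hW, ← hz', WithTop.untopD_coe] at this
    rw [div_le_div_iff₀ (by positivity) (by positivity)] at this
    have h3 : W * j ≤ z' * n := by exact_mod_cast this
    have h4 : z' ≤ z := by rw [← hz'] at hz; exact_mod_cast hz
    have h5 : (n : ℤ) * z' ≤ n * z := mul_le_mul_of_nonneg_left h4 (by positivity)
    linarith
  refine ⟨r, hr, n, W, hn1, hn2, hW.symm, ?_, ?_⟩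
  · have h1 := hall v hv k hk zk hzk.ge
    have h2 : (n : ℤ) * zk < 0 := mul_neg_of_pos_of_neg (by exact_mod_cast hn1) hzk0
    by_contra hc
    have : 0 ≤ (k : ℤ) * W := mul_nonneg (by positivity) (not_lt.mp hc)
    omega
  · intro t ht j z hz
    rcases Nat.eq_zero_or_pos j with rfl | hj
    · rw [h.zero_self] at hz
      have : (0 : ℤ) ≤ z := by exact_mod_cast hz
      simpa using mul_nonneg (by positivity : (0 : ℤ) ≤ n) this
    · exact hall t ht j hj z hz

/-- Shortening with modulus 1 reduces to walks of fewer than `|S|` steps, whose minimal weights form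
a finite set; infinite entries only contribute the default 0 to the bound. -/
theorem exists_lower_bound (h : MinPlusPowers P) (hcl : Closed S' P)
    (hnn : ∀ n, ∀ s ∈ S', 0 ≤ P n s s) :
    ∃ D : ℕ, ∀ s ∈ S', ∀ N r, ∀ z : ℤ, P N s r ≤ z → -(D : ℤ) ≤ z := by
  refine ⟨Finset.univ.sup fun e : Fin (Fintype.card S) × S × S =>
    ((P e.1 e.2.1 e.2.2).untopD 0).natAbs, ?_⟩
  intro s hs N r z hz
  obtain ⟨N', hN', -, hle⟩ := h.exists_shorter hcl hnn hs le_rfl N hz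
  rw [mul_one] at hN'
  obtain ⟨x, hx⟩ := WithTop.ne_top_iff_exists.mp (ne_top_of_le_coe hle)
  have h1 := Finset.le_sup (f := fun e : Fin (Fintype.card S) × S × S =>
    ((P e.1 e.2.1 e.2.2).untopD 0).natAbs) (Finset.mem_univ ((⟨N', hN'⟩, s, r) : _ × _ × _))
  simp only [← hx, WithTop.untopD_coe] at h1
  rw [← hx] at hle
  have h2 : x ≤ z := by exact_mod_cast hle
  omega

/-- A long walk of small weight visits a state with a cycle of weight zero. -/
theorem exists_zero_cycle_of_long (h : MinPlusPowers P) (hcl : Closed S' P)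
    (hnn : ∀ n, ∀ s ∈ S', 0 ≤ P n s s) (B : ℤ) :
    ∃ N₀, ∀ N ≥ N₀, ∀ s ∈ S', ∀ r, ∀ z : ℤ, z ≤ B → P N s r = z →
      ∃ v ∈ S', ∃ i ≤ N, ∃ x y c, 1 ≤ c ∧ P i s v ≤ (x : ℤ) ∧ P (N - i) v r ≤ (y : ℤ) ∧ x + y = z ∧
        P c v v ≤ 0 := by
  obtain ⟨D, hD⟩ := h.exists_lower_bound hcl hnn
  -- Prefix and suffix both weigh at least `-D`, so accumulated weights stay in `[-D, B + D]`. A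
  -- longer walk repeats a pair (state, accumulated weight), which is a zero cycle.
  refine ⟨Fintype.card S * (Finset.Icc (-(D : ℤ)) (B + D)).card, ?_⟩
  intro N hN s hs r z hzB hz
  obtain ⟨ρ, f, h0, hr, hf0, hfN, hle⟩ := h.exists_walk N s r (by rw [hz]; exact WithTop.coe_ne_top)
  have hzN : f N = z := by rw [hz] at hfN; exact_mod_cast hfN.symm
  have hpre : ∀ i ≤ N, P i s (ρ i) ≤ ((f i : ℤ) : WithTop ℤ) := by
    intro i hi
    have := hle 0 i (by omega) hi
    rwa [h0, hf0, Nat.sub_zero, sub_zero] at this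
  have hmem : ∀ i ≤ N, ρ i ∈ S' := fun i hi => hcl _ _ hs _ (ne_top_of_le_coe (hpre i hi))
  have hrange : ∀ i : Fin (N + 1), f i ∈ Finset.Icc (-(D : ℤ)) (B + D) := by
    intro i
    have hi : (i : ℕ) ≤ N := by omega
    have h1 := hD s hs _ _ _ (hpre i hi)
    have h2 := hD _ (hmem i hi) _ _ _ (hle i N hi le_rfl)
    rw [Finset.mem_Icc]
    constructor <;> linarith
  obtain ⟨i, j, hij, he⟩ := Fintype.exists_ne_map_eq_of_card_lt
    (fun i : Fin (N + 1) => (ρ i, (⟨f i, hrange i⟩ : Finset.Icc (-(D : ℤ)) (B + D)))) (by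
      simp only [Fintype.card_fin, Fintype.card_prod, Fintype.card_coe]; omega)
  wlog hlt' : i < j generalizing i j
  · exact this j i hij.symm he.symm (lt_of_le_of_ne (not_lt.mp hlt') hij.symm)
  have he1 : ρ i = ρ j := (Prod.ext_iff.mp he).1
  have he2 : f i = f j := congrArg Subtype.val (Prod.ext_iff.mp he).2
  have hj := j.2
  have hij' : (i : ℕ) < j := hlt'
  have h2 := hle i j (by omega) (by omega)
  have h3 := hle i N (by omega) le_rfl
  rw [hr] at h3
  rw [← he1, he2, sub_self] at h2
  exact ⟨ρ i, hmem i (by omega), i, by omega, f i, f N - f i, j - i, by omega, hpre i (by omega), h3,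
    by rw [← hzN]; ring, by exact_mod_cast h2⟩

/-- Walks to and from a state with a zero cycle, of length a multiple of `|S| * |S|!`, can be
replaced by walks of length `|S| * |S|!`. -/
theorem normalize_length (h : MinPlusPowers P) (hcl : Closed S' P)
    (hnn : ∀ n, ∀ s ∈ S', 0 ≤ P n s s) {m : ℕ}
    (hm : m = Fintype.card S * (Fintype.card S).factorial) {g : S} (hg : g ∈ S')
    (hgz : P m g g ≤ 0) {N : ℕ} (hN : m ∣ N) {z : ℤ} :
    (∀ s ∈ S', P N s g ≤ z → P m s g ≤ z) ∧ (∀ r, P N g r ≤ z → P m g r ≤ z) := by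
  have hm1 : 1 ≤ m := by
    rw [hm]
    exact Nat.mul_pos (Fintype.card_pos_iff.mpr ⟨g⟩) (Nat.factorial_pos _)
  obtain ⟨c, hc1, hc2, hc3⟩ := h.exists_short_zero_cycle hcl hnn hg hm1 hgz
  have hcm : c ∣ m := by rw [hm]; exact Dvd.dvd.mul_left (Nat.dvd_factorial hc1 hc2) _
  have hcle : Fintype.card S * c ≤ m := by
    rw [hm]; exact Nat.mul_le_mul_left _ (hc2.trans (Nat.self_le_factorial _))
  -- The factor `|S|!` makes `c` divide `m`, and the factor `|S|` leaves room for the shortened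
  -- walk; the missing length is filled by turns of the zero cycle at `g`.
  have key : ∀ s ∈ S', ∀ r, P N s r ≤ z → ∃ N' e, N' + c * e = m ∧ P N' s r ≤ z := by
    intro s hs r hz
    obtain ⟨N', h1, h2, h3⟩ := h.exists_shorter hcl hnn hs hc1 N hz
    have h4 : c ∣ N' := (Nat.ModEq.dvd_iff h2 dvd_rfl).mpr (hcm.trans hN)
    obtain ⟨e, he⟩ := Nat.dvd_sub hcm h4
    exact ⟨N', e, by omega, h3⟩
  have hpad : ∀ e, P (c * e) g g ≤ ((0 : ℤ) : WithTop ℤ) := fun e => by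
    simpa using h.mul_self_le (x := 0) (by simpa using hc3) e
  constructor
  · intro s hs hz
    obtain ⟨N', e, he, h3⟩ := key s hs g hz
    simpa using h.add_le_of_le he h3 (hpad e)
  · intro r hz
    obtain ⟨N', e, he, h3⟩ := key g hg r hz
    simpa using h.add_le_of_le ((Nat.add_comm _ _).trans he) (hpad e) h3

/-- A long walk of small weight can be replaced by one through a state with a zero cycle. -/
theorem exists_grounding (h : MinPlusPowers P) (hcl : Closed S' P)
    (hnn : ∀ n, ∀ s ∈ S', 0 ≤ P n s s) {m : ℕ}
    (hm : m = Fintype.card S * (Fintype.card S).factorial) (B : ℤ) :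
    ∃ N₀, ∀ N ≥ N₀, m ∣ N → ∀ s ∈ S', ∀ r, ∀ z : ℤ, z ≤ B → P N s r = z →
      ∃ g ∈ S', P m g g ≤ 0 ∧ P m s g + P m g r ≤ z := by
  obtain ⟨N₀, hN₀⟩ := h.exists_zero_cycle_of_long hcl hnn B
  refine ⟨N₀, fun N hN hmN s hs r z hzB hz => ?_⟩
  obtain ⟨v, hv, i, hi, x, y, c, hc, hx, hy, hxy, hcv⟩ := hN₀ N hN s hs r z hzB hz
  have hm1 : 1 ≤ m := by
    rw [hm]
    exact Nat.mul_pos (Fintype.card_pos_iff.mpr ⟨v⟩) (Nat.factorial_pos _)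
  obtain ⟨c, hc1, hc2, hc3⟩ := h.exists_short_zero_cycle hcl hnn hv hc hcv
  obtain ⟨e, he⟩ : c ∣ m := by rw [hm]; exact Dvd.dvd.mul_left (Nat.dvd_factorial hc1 hc2) _
  have hvm : P m v v ≤ ((0 : ℤ) : WithTop ℤ) := by
    rw [he]; simpa using h.mul_self_le (x := 0) (by simpa using hc3) e
  have him : i % m < m := Nat.mod_lt _ hm1
  -- The cycle at `v` is followed until the position is a multiple of `m` (one full turn if `m ∣
  -- i`). The state `g` met there lies on the same cycle of length `m`, and now both halves of the
  -- walk have length divisible by `m`.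
  obtain ⟨g, hg⟩ := h.exists_split (m - i % m) (i % m) v v
  rw [Nat.sub_add_cancel him.le] at hg
  have hfin : P (m - i % m) v g + P (i % m) g v ≠ ⊤ := hg ▸ ne_top_of_le_coe hvm
  obtain ⟨p, hp⟩ := WithTop.ne_top_iff_exists.mp (WithTop.add_ne_top.mp hfin).1
  obtain ⟨q, hq⟩ := WithTop.ne_top_iff_exists.mp (WithTop.add_ne_top.mp hfin).2
  have hpq : p + q ≤ 0 := by rw [hg, ← hp, ← hq] at hvm; exact_mod_cast hvm
  have hgS : g ∈ S' := hcl _ _ hv _ (by rw [← hp]; exact WithTop.coe_ne_top)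
  have hgz : P m g g ≤ 0 :=
    (h.add_le_of_le (n := m) (by omega) hq.ge hp.ge).trans (by exact_mod_cast (by omega))
  have hdiv : i + (m - i % m) = m * (i / m + 1) := by
    have := Nat.div_add_mod i m
    rw [Nat.mul_add]; omega
  have h1 := h.add_le_of_le (n := m * (i / m + 1)) hdiv hx hp.ge
  have h2 := h.add_le_of_le (n := i % m + (N - i)) rfl hq.ge hy
  have hd2 : m ∣ i % m + (N - i) := by
    have := Nat.div_add_mod i m
    have e3 : i % m + (N - i) = N - m * (i / m) := by omega
    rw [e3]; exact Nat.dvd_sub hmN (dvd_mul_right _ _)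
  refine ⟨g, hgS, hgz, ?_⟩
  have h3 := (h.normalize_length hcl hnn hm hgS hgz (dvd_mul_right _ _)).1 s hs h1
  have h4 := (h.normalize_length hcl hnn hm hgS hgz hd2).2 r h2
  exact (add_le_add h3 h4).trans (by exact_mod_cast (by omega))

end MinPlusPowers

end Powers

/-! ### Min-plus products along words and their powers -/

section Words

variable {S : Type*} [Fintype S] [DecidableEq S]

theorem minWt_cons_le (M : WMat S) (l : List (WMat S)) (s t r : S) :
    minWt (M :: l) s r ≤ M s t + minWt l t r :=
  Finset.inf_le (f := fun t => M s t + minWt l t r) (Finset.mem_univ t)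

theorem exists_minWt_cons (M : WMat S) (l : List (WMat S)) (s r : S) :
    ∃ t, minWt (M :: l) s r = M s t + minWt l t r := by
  obtain ⟨t, -, ht⟩ := Finset.exists_mem_eq_inf (Finset.univ : Finset S) ⟨s, Finset.mem_univ s⟩
    (fun t => M s t + minWt l t r)
  exact ⟨t, ht⟩

theorem minWt_nil_self (s : S) : minWt [] s s = 0 := by simp [minWt]

theorem eq_of_minWt_nil_ne_top {s r : S} (h : minWt [] s r ≠ ⊤) : s = r := by
  by_contra hs
  simp [minWt, hs] at h

theorem minWt_append_le (l l' : List (WMat S)) (s t r : S) :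
    minWt (l ++ l') s r ≤ minWt l s t + minWt l' t r := by
  induction l generalizing s with
  | nil =>
    by_cases hs : s = t
    · subst hs; simp [minWt_nil_self]
    · simp [minWt, hs]
  | cons M l ih =>
    obtain ⟨q, hq⟩ := exists_minWt_cons M l s t
    rw [hq, add_assoc]
    exact (minWt_cons_le M (l ++ l') s q r).trans (add_le_add le_rfl (ih q))

theorem exists_minWt_append (l l' : List (WMat S)) (s r : S) :
    ∃ t, minWt (l ++ l') s r = minWt l s t + minWt l' t r := by
  induction l generalizing s with
  | nil => exact ⟨s, by simp [minWt_nil_self]⟩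
  | cons M l ih =>
    obtain ⟨q, hq⟩ := exists_minWt_cons M (l ++ l') s r
    obtain ⟨t, ht⟩ := ih q
    refine ⟨t, le_antisymm (minWt_append_le (M :: l) l' s t r) ?_⟩
    rw [List.cons_append, hq, ht, ← add_assoc]
    exact add_le_add (minWt_cons_le _ _ _ _ _) le_rfl

theorem minWt_singleton (M : WMat S) (s r : S) : minWt [M] s r = M s r := by
  refine le_antisymm ?_ ?_
  · simpa [minWt_nil_self] using minWt_cons_le M [] s r r
  · obtain ⟨t, ht⟩ := exists_minWt_cons M [] s r
    by_cases h : t = r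
    · subst h; simp [ht, minWt_nil_self]
    · rw [ht]; simp [minWt, h]

theorem wordPow_add {X : Type*} (w : List X) (a b : ℕ) :
    wordPow w (a + b) = wordPow w a ++ wordPow w b := by
  simp only [wordPow, List.replicate_add, List.flatten_append]

theorem wordPow_succ {X : Type*} (w : List X) (a : ℕ) : wordPow w (a + 1) = w ++ wordPow w a := by
  simp [wordPow, List.replicate_succ]

theorem wordPow_one {X : Type*} (w : List X) : wordPow w 1 = w := by
  simp [wordPow]

theorem map_wordPow {X Y : Type*} (f : X → Y) (w : List X) (n : ℕ) :
    (wordPow w n).map f = wordPow (w.map f) n := by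
  simp [wordPow, List.map_flatten]

theorem wordPow_mul {X : Type*} (w : List X) (a b : ℕ) :
    wordPow w (a * b) = wordPow (wordPow w a) b := by
  induction b with
  | zero => simp [wordPow]
  | succ b ih => rw [wordPow_succ, ← ih, ← wordPow_add]; ring_nf

theorem mem_of_mem_wordPow {X : Type*} {w : List X} {n : ℕ} {a : X} (h : a ∈ wordPow w n) :
    a ∈ w := by
  simp only [wordPow, List.mem_flatten, List.mem_replicate] at h
  obtain ⟨l, ⟨-, rfl⟩, h⟩ := h
  exact h

theorem length_wordPow {X : Type*} (w : List X) (n : ℕ) : (wordPow w n).length = n * w.length := by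
  simp [wordPow]

theorem minPlusPowers_minWt (l : List (WMat S)) :
    MinPlusPowers fun n => minWt (wordPow l n) where
  zero_self s := by simp [wordPow, minWt]
  eq_of_zero s r h := by
    simp only [wordPow, List.replicate_zero, List.flatten_nil] at h
    exact eq_of_minWt_nil_ne_top h
  add_le a b s t r := by
    simp only [wordPow_add]
    exact minWt_append_le _ _ _ _ _
  exists_split a b s r := by
    simp only [wordPow_add]
    exact exists_minWt_append _ _ _ _

end Words

/-! ### Approximation of weights; classes of states with common base and set -/

/-- `g` has the finite values of `f`, and values at least `F` elsewhere. -/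
def AgreesUpTo {S : Type*} (F : ℤ) (f g : S → WithTop ℤ) : Prop :=
  ∀ r, (f r ≠ ⊤ → g r = f r) ∧ (f r = ⊤ → (F : WithTop ℤ) ≤ g r)

theorem AgreesUpTo.trans {S : Type*} {F : ℤ} {f g k : S → WithTop ℤ} (h₁ : AgreesUpTo F f g)
    (h₂ : AgreesUpTo F g k) : AgreesUpTo F f k := by
  intro r
  constructor
  · intro h
    have h' := (h₁ r).1 h
    rw [(h₂ r).1 (h' ▸ h), h']
  · intro h
    by_cases hg : g r = ⊤
    · exact (h₂ r).2 hg
    · rw [(h₂ r).1 hg]; exact (h₁ r).2 h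

/-- States of the same base and set component. -/
def AState.SameClass {Q : Type*} (s t : AState Q) : Prop := s.base = t.base ∧ s.set = t.set

theorem AState.SameClass.symm {Q : Type*} {s t : AState Q} (h : s.SameClass t) : t.SameClass s :=
  ⟨h.1.symm, h.2.symm⟩

theorem AState.SameClass.trans {Q : Type*} {s t r : AState Q} (h : s.SameClass t)
    (h' : t.SameClass r) : s.SameClass r :=
  ⟨h.1.trans h'.1, h.2.trans h'.2⟩

theorem AState.SameClass.refl {Q : Type*} (s : AState Q) : s.SameClass s := ⟨rfl, rfl⟩

/-- Transitions whose base and set component depend only on those of the source. -/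
def ClassDet {Q : Type*} (M : WMat (AState Q)) : Prop :=
  ∀ s s' t t', s.SameClass s' → M s t ≠ ⊤ → M s' t' ≠ ⊤ → t.SameClass t'

theorem classDet_minWt {Q : Type*} [Fintype Q] [DecidableEq Q] {l : List (WMat (AState Q))}
    (h : ∀ M ∈ l, ClassDet M) : ClassDet (minWt l) := by
  induction l with
  | nil =>
    intro s s' t t' hs ht ht'
    rw [← eq_of_minWt_nil_ne_top ht, ← eq_of_minWt_nil_ne_top ht']
    exact hs
  | cons M l ih =>
    intro s s' t t' hs ht ht'
    obtain ⟨q, hq⟩ := exists_minWt_cons M l s t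
    obtain ⟨q', hq'⟩ := exists_minWt_cons M l s' t'
    rw [hq, WithTop.add_ne_top] at ht
    rw [hq', WithTop.add_ne_top] at ht'
    exact ih (fun M hM => h M (List.mem_cons_of_mem _ hM)) q q' t t'
      (h M List.mem_cons_self s s' q q' hs ht.1 ht'.1) ht.2 ht'.2

theorem subWt_ne_top {a c : WithTop ℤ} (h : subWt a c ≠ ⊤) : a ≠ ⊤ ∧ c ≠ ⊤ := by
  cases c with
  | top => simp [subWt] at h
  | coe c => simpa [subWt] using h

theorem subWt_add_cancel {a c : WithTop ℤ} (h : c ≠ ⊤) : subWt a c + c = a := by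
  cases c with
  | top => exact absurd rfl h
  | coe c =>
    cases a with
    | top => simp [subWt]
    | coe a => simp only [subWt]; norm_cast; ring

/-! ### Letters, stable cycles and the realisation of cactus letters by powers -/

namespace WFA

variable {Q Sg : Type*} [Fintype Q] [DecidableEq Q] (A : WFA Q Sg)

theorem mwt_wordPow (w : List (Letter Q Sg)) (n : ℕ) :
    A.mwt (wordPow w n) = minWt (wordPow (w.map A.letterWt) n) := by
  rw [mwt, map_wordPow]

theorem powers (w : List (Letter Q Sg)) : MinPlusPowers fun n => A.mwt (wordPow w n) := by
  simp only [mwt_wordPow]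
  exact minPlusPowers_minWt _

theorem mwt_append_le (w w' : List (Letter Q Sg)) (s t r : AState Q) :
    A.mwt (w ++ w') s r ≤ A.mwt w s t + A.mwt w' t r := by
  simp only [mwt, List.map_append]
  exact minWt_append_le _ _ _ _ _

theorem exists_mwt_append (w w' : List (Letter Q Sg)) (s r : AState Q) :
    ∃ t, A.mwt (w ++ w') s r = A.mwt w s t + A.mwt w' t r := by
  simp only [mwt, List.map_append]
  exact exists_minWt_append _ _ _ _

theorem mwt_cons_le (a : Letter Q Sg) (w : List (Letter Q Sg)) (s t r : AState Q) :
    A.mwt (a :: w) s r ≤ A.letterWt a s t + A.mwt w t r :=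
  minWt_cons_le _ _ _ _ _

theorem exists_mwt_cons (a : Letter Q Sg) (w : List (Letter Q Sg)) (s r : AState Q) :
    ∃ t, A.mwt (a :: w) s r = A.letterWt a s t + A.mwt w t r :=
  exists_minWt_cons _ _ _ _

theorem mwt_singleton (a : Letter Q Sg) (s r : AState Q) : A.mwt [a] s r = A.letterWt a s r :=
  minWt_singleton _ _ _

theorem mwt_nil_self (s : AState Q) : A.mwt [] s s = 0 := minWt_nil_self s

theorem eq_of_mwt_nil_ne_top {s r : AState Q} (h : A.mwt [] s r ≠ ⊤) : s = r :=
  eq_of_minWt_nil_ne_top h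

theorem letterWt_base (p : Q) (σ : Sg) (q : Q) : A.letterWt (.base p σ q) = A.baseWt p σ q := by
  simp [letterWt]

theorem letterWt_cactus (S' : Finset (AState Q)) (w : List (Letter Q Sg)) :
    A.letterWt (.cactus S' w) = cactusWt S' (w.map A.letterWt) := by
  simp [letterWt]

theorem letterWt_rebase (S' : Finset (AState Q)) (w : List (Letter Q Sg)) (s r : AState Q) :
    A.letterWt (.rebase S' w s r) = rebaseWt (A.letterWt (.cactus S' w)) s r := by
  simp [letterWt]

theorem letterWt_jump (s r : AState Q) :
    A.letterWt (.jump s r : Letter Q Sg) = jumpWt s r := by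
  simp [letterWt]

theorem baseWt_of_ne_top {p : Q} {σ : Sg} {q : Q} {x y : AState Q} (h : A.baseWt p σ q x y ≠ ⊤) :
    x.base = p ∧ y.base = q ∧ y.set = A.reach x.set σ ∧ A.wt x.inner σ y.inner ≠ ⊤ ∧
      A.wt p σ q ≠ ⊤ := by
  unfold baseWt at h
  split_ifs at h with hc
  · exact ⟨hc.1, hc.2.1, hc.2.2, subWt_ne_top h⟩
  · exact absurd rfl h

theorem letterWt_cactus_le {S' : Finset (AState Q)} {w : List (Letter Q Sg)} {s r g : AState Q}
    (hs : s ∈ S') (hr : r ∈ S') (hg : g ∈ minStates S' (A.mwt (wordPow w (stabConst Q)))) :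
    A.letterWt (.cactus S' w) s r ≤
      A.mwt (wordPow w (stabConst Q)) s g + A.mwt (wordPow w (stabConst Q)) g r := by
  rw [mwt_wordPow] at hg ⊢
  rw [letterWt_cactus, cactusWt, if_pos ⟨hs, hr⟩]
  exact Finset.inf_le (f := fun g => minWt (wordPow (w.map A.letterWt) (stabConst Q)) s g +
        minWt (wordPow (w.map A.letterWt) (stabConst Q)) g r) hg

theorem exists_of_letterWt_cactus_ne_top {S' : Finset (AState Q)} {w : List (Letter Q Sg)}
    {s r : AState Q} (h : A.letterWt (.cactus S' w) s r ≠ ⊤) :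
    s ∈ S' ∧ r ∈ S' ∧ ∃ g ∈ minStates S' (A.mwt (wordPow w (stabConst Q))),
      A.letterWt (.cactus S' w) s r =
      A.mwt (wordPow w (stabConst Q)) s g + A.mwt (wordPow w (stabConst Q)) g r := by
  rw [letterWt_cactus, cactusWt] at h
  rw [mwt_wordPow, letterWt_cactus, cactusWt]
  split_ifs at h ⊢ with hc
  · refine ⟨hc.1, hc.2, ?_⟩
    rcases (minStates S' (minWt (wordPow (w.map A.letterWt) (stabConst Q)))).eq_empty_or_nonempty
      with he | hne
    · rw [he] at h; simp at h
    · exact Finset.exists_mem_eq_inf _ hne _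
  · exact absurd rfl h

theorem isGrounded_of_letterWt_ne_top {S' : Finset (AState Q)} {w : List (Letter Q Sg)}
    {s r : AState Q} (h : A.letterWt (.cactus S' w) s r ≠ ⊤) : A.IsGrounded S' w s r := by
  obtain ⟨hs, hr, g, hg, he⟩ := A.exists_of_letterWt_cactus_ne_top h
  rw [he, WithTop.add_ne_top] at h
  exact ⟨hs, hr, g, hg, h⟩

variable {A}

theorem IsFullSet.sameClass {S' : Finset (AState Q)} {q : Q} {T : Finset Q}
    (h : IsFullSet S' q T) {s t : AState Q} (hs : s ∈ S') (ht : t ∈ S') : s.SameClass t := by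
  rw [h] at hs ht
  exact ⟨hs.1.trans ht.1.symm, hs.2.trans ht.2.symm⟩

theorem IsReflexiveCycle.mem_of_sameClass {S' : Finset (AState Q)} {w : List (Letter Q Sg)}
    (h : A.IsReflexiveCycle S' w) {s t : AState Q} (hs : s ∈ S') (hst : s.SameClass t) :
    t ∈ S' := by
  obtain ⟨⟨q, T, hf⟩, -⟩ := h
  rw [hf] at hs ⊢
  exact ⟨hst.1.symm.trans hs.1, hst.2.symm.trans hs.2⟩

theorem IsReflexiveCycle.closed {S' : Finset (AState Q)} {w : List (Letter Q Sg)}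
    (h : A.IsReflexiveCycle S' w) :
    MinPlusPowers.Closed S' fun n => A.mwt (wordPow w n) := by
  intro n
  induction n with
  | zero =>
    intro s hs r hr
    rwa [← (A.powers w).eq_of_zero s r hr]
  | succ n ih =>
    intro s hs r hr
    obtain ⟨t, ht⟩ := (A.powers w).exists_split n 1 s r
    simp only [wordPow_one] at ht hr
    rw [ht, WithTop.add_ne_top] at hr
    exact h.2 t (ih s hs t hr.1) r hr.2

/-- The baseline cycle weighs 0 and is minimal among all cycles. -/
theorem IsStableCycle.nonneg {S' : Finset (AState Q)} {w : List (Letter Q Sg)}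
    (h : A.IsStableCycle S' w) (n : ℕ) : ∀ s ∈ S', 0 ≤ A.mwt (wordPow w n) s s := by
  intro s hs
  obtain ⟨-, b, -, -, hb⟩ := h
  obtain ⟨hm, h0⟩ := hb n
  by_cases ht : A.mwt (wordPow w n) s s = ⊤
  · rw [ht]; exact le_top
  · rw [← h0]
    exact (Finset.mem_filter.mp hm).2 s (Finset.mem_filter.mpr ⟨hs, ht⟩)

theorem mem_minStates_of_nonpos {S' : Finset (AState Q)} {P : WMat (AState Q)}
    (h : ∀ s ∈ S', 0 ≤ P s s) {g : AState Q} (hg : g ∈ S') (h0 : P g g ≤ 0) :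
    g ∈ minStates S' P := by
  refine Finset.mem_filter.mpr ⟨Finset.mem_filter.mpr ⟨hg, ?_⟩, fun r hr => ?_⟩
  · exact ne_top_of_le_ne_top WithTop.zero_ne_top h0
  · exact h0.trans (h r (Finset.mem_filter.mp hr).1)

/-- With `mem_minStates_of_nonpos` this identifies the minimal states of a stable cycle with the
states having a nonpositive cycle. -/
theorem IsStableCycle.of_mem_minStates {S' : Finset (AState Q)} {w : List (Letter Q Sg)}
    (h : A.IsStableCycle S' w) {n : ℕ} {g : AState Q}
    (hg : g ∈ minStates S' (A.mwt (wordPow w n))) : g ∈ S' ∧ A.mwt (wordPow w n) g g ≤ 0 := by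
  obtain ⟨-, b, -, -, hb⟩ := h
  obtain ⟨hm, h0⟩ := hb n
  rw [minStates, Finset.mem_filter] at hg
  refine ⟨(Finset.mem_filter.mp hg.1).1, ?_⟩
  rw [← h0]
  exact hg.2 b (Finset.mem_filter.mp hm).1

/-- A standard letter prescribes the new base and computes the new set from the old one; a cactus
letter stays in `S'`, a single class. -/
theorem IsCac.classDet {L : ℕ → ℕ} {a : Letter Q Sg} (ha : A.IsCac L a) :
    ClassDet (A.letterWt a) := by
  intro s s' t t' hs ht ht'
  cases ha with
  | base p σ q =>
    rw [letterWt_base] at ht ht'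
    obtain ⟨-, h1, h2, -⟩ := A.baseWt_of_ne_top ht
    obtain ⟨-, h1', h2', -⟩ := A.baseWt_of_ne_top ht'
    exact ⟨h1.trans h1'.symm, by rw [h2, h2', hs.2]⟩
  | cactus S' w letters stable nondeg depth len =>
    obtain ⟨⟨q, T, hf⟩, -⟩ := stable.1
    exact hf.sameClass (A.exists_of_letterWt_cactus_ne_top ht).2.1
      (A.exists_of_letterWt_cactus_ne_top ht').2.1

theorem classDet_mwt {L : ℕ → ℕ} {w : List (Letter Q Sg)} (hw : ∀ a ∈ w, A.IsCac L a) :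
    ClassDet (A.mwt w) := by
  refine classDet_minWt fun M hM => ?_
  obtain ⟨a, ha, rfl⟩ := List.mem_map.mp hM
  exact (hw a ha).classDet

theorem IsCac.of_isBase {a : Letter Q Sg} (L : ℕ → ℕ) (h : a.IsBase) : A.IsCac L a := by
  cases a with
  | base p σ q => exact .base p σ q
  | _ => exact h.elim

theorem stabConst_pos [Nonempty (AState Q)] : 1 ≤ stabConst Q :=
  Nat.mul_pos Fintype.card_pos (Nat.factorial_pos _)

/-- High powers of a stable cycle realise the transitions of its cactus letter. -/
theorem IsStableCycle.exists_agreesUpTo {S' : Finset (AState Q)} {w : List (Letter Q Sg)}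
    (h : A.IsStableCycle S' w) (F : ℤ) :
    ∃ N, ∀ s ∈ S', AgreesUpTo F (A.letterWt (.cactus S' w) s) (A.mwt (wordPow w N) s) := by
  -- `B` dominates both the error threshold and all finite weights of the cactus letter, so one
  -- application of `exists_grounding` handles both clauses.
  set B : ℤ := max F (Finset.univ.sup fun e : AState Q × AState Q =>
    ((A.letterWt (.cactus S' w) e.1 e.2).untopD 0).natAbs : ℕ) with hB
  have hBle : ∀ s r, ∀ z : ℤ, A.letterWt (.cactus S' w) s r = z → z ≤ B := by
    intro s r z hz
    have h1 := Finset.le_sup (f := fun e : AState Q × AState Q =>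
      ((A.letterWt (.cactus S' w) e.1 e.2).untopD 0).natAbs) (Finset.mem_univ (s, r))
    simp only [hz, WithTop.untopD_coe] at h1
    refine le_max_of_le_right ?_
    omega
  obtain ⟨N₀, hN₀⟩ := (A.powers w).exists_grounding h.1.closed h.nonneg
    (m := stabConst Q) rfl B
  have hlow : ∀ N ≥ N₀, stabConst Q ∣ N → ∀ s ∈ S', ∀ r, ∀ z : ℤ, z ≤ B →
      A.mwt (wordPow w N) s r = z → A.letterWt (.cactus S' w) s r ≤ z := by
    intro N hN hd s hs r z hzB hz
    obtain ⟨g, hg, hgz, hle⟩ := hN₀ N hN hd s hs r z hzB hz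
    have hr : r ∈ S' := h.1.closed N s hs r (by simp only [hz]; exact WithTop.coe_ne_top)
    exact (A.letterWt_cactus_le hs hr (mem_minStates_of_nonpos (h.nonneg _) hg hgz)).trans hle
  -- One block to reach `g`, `N₀` blocks idling on its zero cycle, one block to leave: a multiple of
  -- `𝔪` that is at least `N₀`.
  refine ⟨stabConst Q + (stabConst Q * N₀ + stabConst Q), fun s hs r => ?_⟩
  have : Nonempty (AState Q) := ⟨s⟩
  have hm := stabConst_pos (Q := Q)
  have hge : stabConst Q + (stabConst Q * N₀ + stabConst Q) ≥ N₀ := by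
    have := Nat.le_mul_of_pos_left N₀ hm
    omega
  have hd : stabConst Q ∣ stabConst Q + (stabConst Q * N₀ + stabConst Q) :=
    ⟨1 + (N₀ + 1), by ring⟩
  constructor
  · intro hfin
    obtain ⟨hs, hr, g, hg, he⟩ := A.exists_of_letterWt_cactus_ne_top hfin
    obtain ⟨hgS, hg0⟩ := h.of_mem_minStates hg
    obtain ⟨z, hz⟩ := WithTop.ne_top_iff_exists.mp hfin
    have hle : A.mwt (wordPow w (stabConst Q + (stabConst Q * N₀ + stabConst Q))) s r ≤
        A.letterWt (.cactus S' w) s r := by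
      rw [he]
      refine ((A.powers w).add_le _ _ s g r).trans (add_le_add le_rfl ?_)
      refine ((A.powers w).add_le _ _ g g r).trans ?_
      have := (A.powers w).mul_self_le (x := 0) hg0 N₀
      simp only [mul_zero] at this
      exact (add_le_add this le_rfl).trans (by simp)
    refine le_antisymm hle ?_
    rw [← hz] at hle
    obtain ⟨z', hz'⟩ := WithTop.ne_top_iff_exists.mp (MinPlusPowers.ne_top_of_le_coe hle)
    rw [← hz'] at hle ⊢
    have h1 : z' ≤ z := by exact_mod_cast hle
    exact hlow _ hge hd s hs r z' (h1.trans (hBle s r z hz.symm)) hz'.symm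
  · intro htop
    by_contra hlt
    rw [not_le] at hlt
    obtain ⟨z', hz'⟩ := WithTop.ne_top_iff_exists.mp (ne_top_of_lt hlt)
    rw [← hz'] at hlt
    have h1 : z' < F := by exact_mod_cast hlt
    have := hlow _ hge hd s hs r z' (h1.le.trans (le_max_left _ _)) hz'.symm
    rw [htop, top_le_iff] at this
    exact WithTop.coe_ne_top this

end WFA

theorem exists_abs_bound {S : Type*} [Fintype S] (M : WMat S) :
    ∃ B : ℕ, ∀ s r, ∀ z : ℤ, M s r = z → |z| ≤ B := by
  refine ⟨Finset.univ.sup fun e : S × S => ((M e.1 e.2).untopD 0).natAbs, fun s r z hz => ?_⟩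
  have h1 := Finset.le_sup (f := fun e : S × S => ((M e.1 e.2).untopD 0).natAbs)
    (Finset.mem_univ (s, r))
  simp only [hz, WithTop.untopD_coe] at h1
  rw [Int.abs_eq_natAbs]
  exact_mod_cast h1

/-! ### Moving states and transitions to another baseline -/

namespace AState

variable {Q : Type*}

theorem eq_of_components {x y : AState Q} (h₁ : x.inner = y.inner) (h₂ : x.base = y.base)
    (h₃ : x.set = y.set) : x = y := by
  cases x; cases y; simp_all

/-- `x'` is `x` with the base component moved from the inner state of `s` to the base of `s`. -/
structure Rebased (s x x' : AState Q) : Prop where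
  base_eq : x.base = s.inner
  set_eq : x.set = s.set
  inner_eq : x'.inner = x.inner
  base_eq' : x'.base = s.base
  set_eq' : x'.set = s.set

theorem exists_rebased_of_sameClass {s x' : AState Q} (h : s.SameClass x') :
    ∃ x, Rebased s x x' :=
  ⟨⟨x'.inner, s.inner, s.set, h.2 ▸ x'.inner_mem, s.inner_mem⟩, rfl, rfl, rfl, h.1.symm, h.2.symm⟩

theorem exists_rebased {s x : AState Q} (hb : x.base = s.inner) (hT : x.set = s.set) :
    ∃ x', Rebased s x x' :=
  ⟨⟨x.inner, s.base, s.set, hT ▸ x.inner_mem, s.base_mem⟩, hb, hT, rfl, rfl, rfl⟩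

theorem Rebased.sameClass {s x x' : AState Q} (h : Rebased s x x') : s.SameClass x' :=
  ⟨h.base_eq'.symm, h.set_eq'.symm⟩

theorem Rebased.eq_iff {s x x' y y' : AState Q} (h : Rebased s x x') (h' : Rebased s y y') :
    x = y ↔ x' = y' := by
  constructor
  · rintro rfl
    exact eq_of_components (h.inner_eq.trans h'.inner_eq.symm) (h.base_eq'.trans h'.base_eq'.symm)
      (h.set_eq'.trans h'.set_eq'.symm)
  · rintro rfl
    exact eq_of_components (h.inner_eq.symm.trans h'.inner_eq) (h.base_eq.trans h'.base_eq.symm)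
      (h.set_eq.trans h'.set_eq.symm)

end AState

/-- `M'` is `M` with the transition `s → r`, of weight `W`, as its baseline. -/
def RebasesTo {Q : Type*} (M M' : WMat (AState Q)) (s r : AState Q) (W : WithTop ℤ) : Prop :=
  ∀ x x', AState.Rebased s x x' →
    (∀ y y', AState.Rebased r y y' → M' x y + W = M x' y') ∧
    ∀ y, M' x y ≠ ⊤ → y.base = r.inner ∧ y.set = r.set

theorem subWt_add_subWt {a b c : WithTop ℤ} (hb : b ≠ ⊤) (hc : c ≠ ⊤) :
    subWt a b + subWt b c = subWt a c := by
  cases c with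
  | top => exact absurd rfl hc
  | coe c =>
    cases b with
    | top => exact absurd rfl hb
    | coe b =>
      cases a with
      | top => simp [subWt]
      | coe a => simp only [subWt]; norm_cast; ring

namespace WFA

variable {Q Sg : Type*} [Fintype Q] [DecidableEq Q] (A : WFA Q Sg)

/-! ### Unfolding cactus letters -/

/-- `w` can be read from the class of `s`. -/
def Live (w : List (Letter Q Sg)) (s : AState Q) : Prop :=
  ∃ s' t, s.SameClass s' ∧ A.mwt w s' t ≠ ⊤

/-- Some words over the standard letters approximate `w`, with arbitrarily large error weights. -/
def Flattenable (w : List (Letter Q Sg)) : Prop :=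
  ∀ F : ℤ, ∃ w' : List (Letter Q Sg), (∀ a ∈ w', a.IsBase) ∧
    ∀ s, A.Live w s → AgreesUpTo F (A.mwt w s) (A.mwt w' s)

variable {A}

/-- Runs of the approximating word either follow genuine runs of both factors or pay an error weight
too large to affect any finite value. -/
theorem Flattenable.append {w₁ w₂ : List (Letter Q Sg)} (h₁ : A.Flattenable w₁)
    (h₂ : A.Flattenable w₂) : A.Flattenable (w₁ ++ w₂) := by
  intro F
  obtain ⟨B₁, hB₁⟩ := exists_abs_bound (A.mwt w₁)
  obtain ⟨B₂, hB₂⟩ := exists_abs_bound (A.mwt w₂)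
  -- A spurious factor costs at least `F'` while a genuine one weighs at least `-B₁` or `-B₂`, so
  -- the sum still exceeds `F` and every finite weight of `w₁ ++ w₂`.
  set F' : ℤ := |F| + 2 * B₁ + 2 * B₂ with hF'
  have hFF : F ≤ |F| := le_abs_self F
  have hF0 : 0 ≤ |F| := abs_nonneg F
  obtain ⟨w₁', hb₁, ha₁⟩ := h₁ F'
  obtain ⟨w₂', hb₂, ha₂⟩ := h₂ F'
  refine ⟨w₁' ++ w₂', ?_, ?_⟩
  · intro a ha
    rcases List.mem_append.mp ha with ha | ha
    exacts [hb₁ a ha, hb₂ a ha]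
  rintro s ⟨s', r', hss', hr'⟩ r
  obtain ⟨t, ht⟩ := A.exists_mwt_append w₁ w₂ s' r'
  rw [ht, WithTop.add_ne_top] at hr'
  have hl₁ : A.Live w₁ s := ⟨s', t, hss', hr'.1⟩
  have hl₁' : A.Live w₁ s' := ⟨s', t, .refl _, hr'.1⟩
  have ht' : A.mwt w₁' s' t ≠ ⊤ := by rw [(ha₁ s' hl₁' t).1 hr'.1]; exact hr'.1
  have hdet : ClassDet (A.mwt w₁') := classDet_mwt (L := 0) fun a ha => .of_isBase _ (hb₁ a ha)
  -- Even a state reached only spuriously is in the class of `t`, from which `w₂` can be read; this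
  -- is why `Live` speaks of classes rather than states.
  have hlive : ∀ q, A.mwt w₁' s q ≠ ⊤ → A.Live w₂ q := fun q hq =>
    ⟨t, r', hdet s s' q t hss' hq ht', hr'.2⟩
  have key : ∀ q, ∀ x y : ℤ, A.mwt w₁' s q = x → A.mwt w₂' q r = y →
      A.mwt w₁ s q + A.mwt w₂ q r = ((x + y : ℤ) : WithTop ℤ) ∨ F + B₁ + B₂ ≤ x + y ∧
        (B₁ + B₂ : ℤ) ≤ x + y := by
    intro q x y hx hy
    have hq := hlive q (by rw [hx]; exact WithTop.coe_ne_top)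
    by_cases h1 : A.mwt w₁ s q = ⊤
    · have hx1 := (ha₁ s hl₁ q).2 h1
      rw [hx] at hx1
      have hx2 : F' ≤ x := by exact_mod_cast hx1
      right
      by_cases h2 : A.mwt w₂ q r = ⊤
      · have hy1 := (ha₂ q hq r).2 h2
        rw [hy] at hy1
        have hy2 : F' ≤ y := by exact_mod_cast hy1
        omega
      · have hy1 := (ha₂ q hq r).1 h2
        rw [hy] at hy1
        have := abs_le.mp (hB₂ q r y hy1.symm)
        omega
    · have hx1 := (ha₁ s hl₁ q).1 h1
      rw [hx] at hx1
      have hx2 := abs_le.mp (hB₁ s q x hx1.symm)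
      by_cases h2 : A.mwt w₂ q r = ⊤
      · right
        have hy1 := (ha₂ q hq r).2 h2
        rw [hy] at hy1
        have hy2 : F' ≤ y := by exact_mod_cast hy1
        omega
      · left
        have hy1 := (ha₂ q hq r).1 h2
        rw [hy] at hy1
        rw [← hx1, ← hy1, WithTop.coe_add]
  obtain ⟨q', hq'⟩ := A.exists_mwt_append w₁' w₂' s r
  constructor
  · intro hfin
    obtain ⟨q, hq⟩ := A.exists_mwt_append w₁ w₂ s r
    have hq2 := hfin
    rw [hq, WithTop.add_ne_top] at hq2
    have hle : A.mwt (w₁' ++ w₂') s r ≤ A.mwt (w₁ ++ w₂) s r := by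
      have h1 := (ha₁ s hl₁ q).1 hq2.1
      rw [hq, ← h1, ← (ha₂ q (hlive q (h1 ▸ hq2.1)) r).1 hq2.2]
      exact A.mwt_append_le _ _ _ _ _
    refine le_antisymm hle ?_
    have hfin' := ne_top_of_le_ne_top hfin hle
    rw [hq', WithTop.add_ne_top] at hfin'
    obtain ⟨x, hx⟩ := WithTop.ne_top_iff_exists.mp hfin'.1
    obtain ⟨y, hy⟩ := WithTop.ne_top_iff_exists.mp hfin'.2
    rw [hq', ← hx, ← hy, ← WithTop.coe_add]
    rcases key q' x y hx.symm hy.symm with h | h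
    · rw [← h]; exact A.mwt_append_le _ _ _ _ _
    · obtain ⟨x', hx'⟩ := WithTop.ne_top_iff_exists.mp hq2.1
      obtain ⟨y', hy'⟩ := WithTop.ne_top_iff_exists.mp hq2.2
      have h1 := abs_le.mp (hB₁ _ _ _ hx'.symm)
      have h2 := abs_le.mp (hB₂ _ _ _ hy'.symm)
      rw [hq, ← hx', ← hy', ← WithTop.coe_add]
      exact_mod_cast (by omega)
  · intro htop
    by_cases hx : A.mwt w₁' s q' = ⊤
    · rw [hq', hx, top_add]; exact le_top
    by_cases hy : A.mwt w₂' q' r = ⊤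
    · rw [hq', hy, add_top]; exact le_top
    obtain ⟨x, hx⟩ := WithTop.ne_top_iff_exists.mp hx
    obtain ⟨y, hy⟩ := WithTop.ne_top_iff_exists.mp hy
    rw [hq', ← hx, ← hy, ← WithTop.coe_add]
    rcases key q' x y hx.symm hy.symm with h | h
    · have := A.mwt_append_le w₁ w₂ s q' r
      rw [htop, h, top_le_iff] at this
      exact absurd this WithTop.coe_ne_top
    · exact_mod_cast (by omega)

theorem Flattenable.nil : A.Flattenable [] := fun F =>
  ⟨[], by simp, fun s _ r => ⟨fun _ => rfl, fun h => h ▸ le_top⟩⟩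

theorem flattenable_of_letters {w : List (Letter Q Sg)} (h : ∀ a ∈ w, A.Flattenable [a]) :
    A.Flattenable w := by
  induction w with
  | nil => exact .nil
  | cons a w ih =>
    exact (h a List.mem_cons_self).append (ih fun c hc => h c (List.mem_cons_of_mem _ hc))

/-- Induction on nesting: a cactus letter is approximated by a high power of its word, whose letters
are flattenable by induction. -/
theorem IsCac.flattenable {L : ℕ → ℕ} {a : Letter Q Sg} (ha : A.IsCac L a) :
    A.Flattenable [a] := by
  induction ha with
  | base p σ q =>
    exact fun F => ⟨[.base p σ q], by simp [Letter.IsBase],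
      fun s _ r => ⟨fun _ => rfl, fun h => h ▸ le_top⟩⟩
  | cactus S' w letters stable nondeg depth len ih =>
    intro F
    obtain ⟨N, hN⟩ := stable.exists_agreesUpTo F
    obtain ⟨w', hw', ha⟩ :=
      flattenable_of_letters (w := wordPow w N) (fun c hc => ih c (mem_of_mem_wordPow hc)) F
    refine ⟨w', hw', ?_⟩
    rintro s ⟨s', t, hss', ht⟩
    rw [mwt_singleton] at ht
    obtain ⟨b, hb, -, hb'⟩ := stable.2
    have hs : s ∈ S' := stable.1.mem_of_sameClass
      (A.exists_of_letterWt_cactus_ne_top ht).1 hss'.symm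
    obtain ⟨⟨q, T, hf⟩, -⟩ := stable.1
    -- The baseline state, in the class of `s`, has a loop of weight 0 on every power.
    have hlive : A.Live (wordPow w N) s :=
      ⟨b, b, hf.sameClass hs hb, by rw [(hb' N).2]; exact WithTop.zero_ne_top⟩
    have h1 := (hN s hs).trans (ha s hlive)
    intro r
    rw [mwt_singleton]
    exact h1 r

/-! ### Change of baseline -/

/-- Intermediate states correspond under the change of base and the subtracted weights add up.
`hdet` gives intermediate states of the original run a rebased copy; for the rebased run, the second
clause of `RebasesTo` does so. -/
theorem RebasesTo.append {w₁ w₂ w₁' w₂' : List (Letter Q Sg)} {s t r : AState Q}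
    {W₁ W₂ : WithTop ℤ} (h₁ : RebasesTo (A.mwt w₁) (A.mwt w₁') s t W₁)
    (h₂ : RebasesTo (A.mwt w₂) (A.mwt w₂') t r W₂)
    (hdet : ∀ x z, s.SameClass x → A.mwt w₁ x z ≠ ⊤ → t.SameClass z) :
    RebasesTo (A.mwt (w₁ ++ w₂)) (A.mwt (w₁' ++ w₂')) s r (W₁ + W₂) := by
  intro x x' hx
  obtain ⟨h₁a, h₁b⟩ := h₁ x x' hx
  constructor
  · intro y y' hy
    refine le_antisymm ?_ ?_
    · obtain ⟨z', hz'⟩ := A.exists_mwt_append w₁ w₂ x' y'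
      by_cases htop : A.mwt w₁ x' z' = ⊤
      · rw [hz', htop, top_add]; exact le_top
      obtain ⟨z, hz⟩ := AState.exists_rebased_of_sameClass (hdet x' z' hx.sameClass htop)
      rw [hz', ← h₁a z z' hz, ← (h₂ z z' hz).1 y y' hy, add_add_add_comm]
      exact add_le_add (A.mwt_append_le _ _ _ _ _) le_rfl
    · obtain ⟨z, hz⟩ := A.exists_mwt_append w₁' w₂' x y
      by_cases htop : A.mwt w₁' x z = ⊤
      · rw [hz, htop, top_add, top_add]; exact le_top
      obtain ⟨z', hz'⟩ := AState.exists_rebased (h₁b z htop).1 (h₁b z htop).2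
      rw [hz, add_add_add_comm, h₁a z z' hz', (h₂ z z' hz').1 y y' hy]
      exact A.mwt_append_le _ _ _ _ _
  · intro y hy
    obtain ⟨z, hz⟩ := A.exists_mwt_append w₁' w₂' x y
    rw [hz, WithTop.add_ne_top] at hy
    obtain ⟨z', hz'⟩ := AState.exists_rebased (h₁b z hy.1).1 (h₁b z hy.1).2
    exact (h₂ z z' hz').2 y hy.2

theorem RebasesTo.nil (s : AState Q) : RebasesTo (A.mwt []) (A.mwt []) s s 0 := by
  intro x x' hx
  constructor
  · intro y y' hy
    simp only [mwt, List.map_nil, minWt, hx.eq_iff hy, add_zero]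
  · intro y hy
    rw [← A.eq_of_mwt_nil_ne_top hy]
    exact ⟨hx.base_eq, hx.set_eq⟩

/-- A standard letter is replaced by the transition between the inner states of `s` and `r`, a
cactus letter by its rebase letter. -/
theorem IsCac.exists_rebase {L : ℕ → ℕ} {a : Letter Q Sg} (ha : A.IsCac L a) {s r : AState Q}
    (h : A.letterWt a s r ≠ ⊤) :
    ∃ a' : Letter Q Sg, A.IsCacReb L a' ∧ (a.IsBase → a'.IsBase) ∧ a'.dep = a.dep ∧
      RebasesTo (A.letterWt a) (A.letterWt a') s r (A.letterWt a s r) := by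
  cases ha with
  | base p σ q =>
    refine ⟨.base s.inner σ r.inner, .cac _ (.base _ _ _), fun _ => trivial, by simp [Letter.dep],
      ?_⟩
    rw [letterWt_base] at h ⊢
    rw [letterWt_base]
    obtain ⟨h1, h2, h3, h4, h5⟩ := A.baseWt_of_ne_top h
    intro x x' hx
    constructor
    · intro y y' hy
      rw [baseWt, if_pos ⟨hx.base_eq, hy.base_eq, by rw [hy.set_eq, hx.set_eq, h3]⟩, baseWt,
        if_pos ⟨h1, h2, h3⟩, baseWt, if_pos ⟨hx.base_eq'.trans h1, hy.base_eq'.trans h2,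
          by rw [hy.set_eq', hx.set_eq', h3]⟩, subWt_add_subWt h4 h5, hx.inner_eq, hy.inner_eq]
    · intro y hy
      obtain ⟨-, hb, hT, -⟩ := A.baseWt_of_ne_top hy
      exact ⟨hb, by rw [hT, h3, hx.set_eq]⟩
  | cactus S' w letters stable nondeg depth len =>
    refine ⟨.rebase S' w s r, .rebase S' w s r (.cactus S' w letters stable nondeg depth len)
      (A.isGrounded_of_letterWt_ne_top h), fun h => h.elim, by simp [Letter.dep], ?_⟩
    rw [letterWt_rebase]
    intro x x' hx
    constructor
    · intro y y' hy
      rw [rebaseWt, dif_pos ⟨hx.set_eq, hy.set_eq, hx.base_eq, hy.base_eq⟩, subWt_add_cancel h]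
      congr 1
      · exact AState.eq_of_components hx.inner_eq.symm hx.base_eq'.symm
          (hx.set_eq.trans hx.set_eq'.symm)
      · exact AState.eq_of_components hy.inner_eq.symm hy.base_eq'.symm
          (hy.set_eq.trans hy.set_eq'.symm)
    · intro y hy
      rw [rebaseWt] at hy
      split_ifs at hy with hc
      · exact ⟨hc.2.2.2, hc.2.1⟩
      · exact absurd rfl hy

/-- Rebase letter by letter along an optimal run from `s` to `r`. Equality of the depth lists also
preserves the length, as the length bounds require. -/
theorem exists_rebase_word {L : ℕ → ℕ} {w : List (Letter Q Sg)} (hw : ∀ a ∈ w, A.IsCac L a)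
    {s r : AState Q} (h : A.mwt w s r ≠ ⊤) :
    ∃ w' : List (Letter Q Sg), (∀ a ∈ w', A.IsCacReb L a) ∧
      ((∀ a ∈ w, a.IsBase) → ∀ a ∈ w', a.IsBase) ∧ w'.map Letter.dep = w.map Letter.dep ∧
      RebasesTo (A.mwt w) (A.mwt w') s r (A.mwt w s r) := by
  induction w generalizing s with
  | nil =>
    obtain rfl := A.eq_of_mwt_nil_ne_top h
    exact ⟨[], by simp, by simp, rfl, by rw [mwt_nil_self]; exact RebasesTo.nil s⟩
  | cons a w ih =>
    obtain ⟨t, ht⟩ := A.exists_mwt_cons a w s r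
    rw [ht, WithTop.add_ne_top] at h
    have haC := hw a List.mem_cons_self
    obtain ⟨a', ha', hab, had, har⟩ := haC.exists_rebase h.1
    obtain ⟨w', hw', hwb, hwd, hwr⟩ := ih (fun c hc => hw c (List.mem_cons_of_mem _ hc)) h.2
    refine ⟨a' :: w', ?_, ?_, by simp [had, hwd], ?_⟩
    · simp only [List.mem_cons, forall_eq_or_imp]
      exact ⟨ha', hw'⟩
    · simp only [List.mem_cons, forall_eq_or_imp]
      exact fun h => ⟨hab h.1, hwb h.2⟩
    · rw [ht]
      have e : ∀ c : Letter Q Sg, A.mwt [c] = A.letterWt c := fun c => by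
        funext x y; exact A.mwt_singleton c x y
      refine RebasesTo.append (w₁ := [a]) (w₁' := [a']) (t := t) (by rw [e, e]; exact har) hwr ?_
      intro x z hx hz
      rw [e] at hz
      exact haC.classDet s x t z hx h.1 hz

theorem RebasesTo.wordPow {w w' : List (Letter Q Sg)} {r : AState Q} {W : ℤ}
    (h : RebasesTo (A.mwt w) (A.mwt w') r r W)
    (hdet : ∀ x z, r.SameClass x → A.mwt w x z ≠ ⊤ → r.SameClass z) (k : ℕ) :
    RebasesTo (A.mwt (wordPow w k)) (A.mwt (wordPow w' k)) r r ((k * W : ℤ) : WithTop ℤ) := by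
  induction k with
  | zero => simpa [_root_.wordPow] using RebasesTo.nil r
  | succ k ih =>
    rw [wordPow_succ, wordPow_succ]
    convert RebasesTo.append h ih hdet using 1
    rw [← WithTop.coe_add]
    congr 1
    push_cast
    ring

end WFA

/-! ### Baseline runs, rebased minimal-mean cycles and the lowest class -/

theorem subWt_coe (a : WithTop ℤ) (c : ℤ) : subWt a c = a + ((-c : ℤ) : WithTop ℤ) := rfl

theorem runWt_append {S : Type*} (l₁ l₂ : List (WMat S)) (s : S) (ρ₁ ρ₂ : List S)
    (h : ρ₁.length = l₁.length) :
    runWt (l₁ ++ l₂) s (ρ₁ ++ ρ₂) =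
      runWt l₁ s ρ₁ + runWt l₂ ((s :: ρ₁).getLast (List.cons_ne_nil s ρ₁)) ρ₂ := by
  induction l₁ generalizing s ρ₁ with
  | nil =>
    obtain rfl := List.length_eq_zero_iff.mp h
    simp [runWt]
  | cons M l₁ ih =>
    cases ρ₁ with
    | nil => simp at h
    | cons t ρ₁ =>
      simp only [List.cons_append, runWt, List.getLast_cons_cons]
      rw [ih t ρ₁ (by simpa using h), add_assoc]

theorem getLast_cons_append {S : Type*} (s : S) (ρ₁ ρ₂ : List S) :
    (s :: (ρ₁ ++ ρ₂)).getLast (List.cons_ne_nil _ _) =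
      ((s :: ρ₁).getLast (List.cons_ne_nil _ _) :: ρ₂).getLast (List.cons_ne_nil _ _) := by
  induction ρ₁ generalizing s with
  | nil => simp
  | cons t ρ₁ ih => simpa only [List.cons_append, List.getLast_cons_cons] using ih t

theorem foldr_max_append (l l' : List ℕ) :
    (l ++ l').foldr max 0 = max (l.foldr max 0) (l'.foldr max 0) := by
  induction l with
  | nil => simp
  | cons a l ih => simp [ih, max_assoc]

theorem Letter.wordDep_wordPow {Q Sg : Type*} (w : List (Letter Q Sg)) (n : ℕ) :
    Letter.wordDep (wordPow w (n + 1)) = Letter.wordDep w := by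
  induction n with
  | zero => simp [wordPow]
  | succ n ih =>
    rw [wordPow_succ, Letter.wordDep, List.map_append, foldr_max_append]
    change max (Letter.wordDep w) (Letter.wordDep (wordPow w (n + 1))) = _
    rw [ih, max_self]

/-- The baseline state in the class of `s`. -/
def AState.baseline {Q : Type*} (s : AState Q) : AState Q :=
  ⟨s.base, s.base, s.set, s.base_mem, s.base_mem⟩

theorem AState.IsBaseline.eq_of_sameClass {Q : Type*} {s t : AState Q} (hs : s.IsBaseline)
    (ht : t.IsBaseline) (h : s.SameClass t) : s = t :=
  AState.eq_of_components (Eq.trans hs (h.1.trans (Eq.symm ht))) h.1 h.2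

namespace WFA

variable {Q Sg : Type*} [Fintype Q] [DecidableEq Q] {A : WFA Q Sg}

theorem IsCac.letterWt_baseline_le {L : ℕ → ℕ} {a : Letter Q Sg} (ha : A.IsCac L a)
    {s t : AState Q} (h : A.letterWt a s t ≠ ⊤) : A.letterWt a s.baseline t.baseline ≤ 0 := by
  cases ha with
  | base p σ q =>
    rw [letterWt_base] at h ⊢
    obtain ⟨h1, h2, h3, h4, h5⟩ := A.baseWt_of_ne_top h
    rw [baseWt, if_pos ⟨h1, h2, h3⟩]
    simp only [AState.baseline, h1, h2]
    obtain ⟨z, hz⟩ := WithTop.ne_top_iff_exists.mp h5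
    rw [← hz, subWt_coe]
    norm_cast
    simp
  | cactus S' w letters stable nondeg depth len =>
    obtain ⟨hs, ht, -⟩ := A.exists_of_letterWt_cactus_ne_top h
    obtain ⟨b, hb, hbb, hst⟩ := stable.2
    obtain ⟨⟨q, T, hf⟩, -⟩ := stable.1
    have e : ∀ c ∈ S', c.baseline = b := fun c hc =>
      AState.IsBaseline.eq_of_sameClass (s := c.baseline) rfl hbb
        ⟨(hf.sameClass hc hb).1, (hf.sameClass hc hb).2⟩
    rw [e s hs, e t ht]
    refine (A.letterWt_cactus_le hb hb (hst _).1).trans ?_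
    rw [(hst _).2, add_zero]

theorem exists_baseline_run {L : ℕ → ℕ} {w : List (Letter Q Sg)} (hw : ∀ a ∈ w, A.IsCac L a)
    {s r : AState Q} (h : A.mwt w s r ≠ ⊤) :
    ∃ ρ : List (AState Q), ρ.length = w.length ∧ (∀ t ∈ ρ, t.IsBaseline) ∧
      runWt (w.map A.letterWt) s.baseline ρ ≤ 0 ∧
      (s.baseline :: ρ).getLast (List.cons_ne_nil _ _) = r.baseline := by
  induction w generalizing s with
  | nil =>
    obtain rfl := A.eq_of_mwt_nil_ne_top h
    exact ⟨[], rfl, by simp, by simp [runWt], rfl⟩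
  | cons a w ih =>
    obtain ⟨t, ht⟩ := A.exists_mwt_cons a w s r
    rw [ht, WithTop.add_ne_top] at h
    obtain ⟨ρ, h1, h2, h3, h4⟩ := ih (fun c hc => hw c (List.mem_cons_of_mem _ hc)) h.2
    refine ⟨t.baseline :: ρ, by simp [h1], ?_, ?_, by rw [List.getLast_cons_cons, h4]⟩
    · simp only [List.mem_cons, forall_eq_or_imp]
      exact ⟨rfl, h2⟩
    · simp only [List.map_cons, runWt]
      exact add_nonpos ((hw a List.mem_cons_self).letterWt_baseline_le h.1) h3

theorem mwt_baseline_le {L : ℕ → ℕ} {w : List (Letter Q Sg)} (hw : ∀ a ∈ w, A.IsCac L a)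
    {s r : AState Q} (h : A.mwt w s r ≠ ⊤) : A.mwt w s.baseline r.baseline ≤ 0 := by
  obtain ⟨ρ, -, -, h3, h4⟩ := exists_baseline_run hw h
  rw [← h4]
  exact (minWt_le_runWt _ _ _).trans h3

/-- The baseline run has total weight at most 0, which is optimal by `h0`. A cheaper prefix,
continued along the baseline, would beat it. -/
theorem hasSeamlessBaselineRun_of_mwt {L : ℕ → ℕ} {w : List (Letter Q Sg)}
    (hw : ∀ a ∈ w, A.IsCac L a) {r : AState Q} (h : A.mwt w A.s0 r ≠ ⊤)
    (h0 : 0 ≤ A.mwt w A.s0 r.baseline) : A.HasSeamlessBaselineRun w := by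
  obtain ⟨ρ, h1, h2, h3, h4⟩ := exists_baseline_run hw h
  have hb : A.s0.baseline = A.s0 := rfl
  simp only [hb] at h3 h4
  refine ⟨ρ, h1, h2, fun i hi => ?_⟩
  have hlen : (ρ.take i).length = ((w.take i).map A.letterWt).length := by simp [h1]
  have hsplit := runWt_append ((w.take i).map A.letterWt) ((w.drop i).map A.letterWt) A.s0
    (ρ.take i) (ρ.drop i) hlen
  have hlast := getLast_cons_append A.s0 (ρ.take i) (ρ.drop i)
  rw [← List.map_append, List.take_append_drop, List.take_append_drop] at hsplit
  simp only [List.take_append_drop, h4] at hlast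
  set t := (A.s0 :: ρ.take i).getLast (List.cons_ne_nil _ _) with ht
  have hfin := ne_top_of_le_ne_top WithTop.zero_ne_top h3
  rw [hsplit, WithTop.add_ne_top] at hfin
  refine ⟨hfin.1, le_antisymm ?_ (minWt_le_runWt _ _ _)⟩
  have e1 : A.mwt w A.s0 r.baseline ≤ A.mwt (w.take i) A.s0 t + A.mwt (w.drop i) t r.baseline := by
    have := A.mwt_append_le (w.take i) (w.drop i) A.s0 t r.baseline
    rwa [List.take_append_drop] at this
  have e2 : A.mwt (w.drop i) t r.baseline ≤ runWt ((w.drop i).map A.letterWt) t (ρ.drop i) := by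
    rw [hlast]
    exact minWt_le_runWt _ _ _
  have e3 := (h3.trans h0).trans (e1.trans (add_le_add le_rfl e2))
  rw [hsplit] at e3
  exact (WithTop.add_le_add_iff_right hfin.2).mp e3

/-- Reading standard letters, every state of the reached class is reached. -/
theorem exists_sameClass_mwt_ne_top {w : List (Letter Q Sg)} (hw : ∀ a ∈ w, a.IsBase)
    {s r r' : AState Q} (h : A.mwt w s r ≠ ⊤) (hr : r.SameClass r') :
    ∃ s', s.SameClass s' ∧ A.mwt w s' r' ≠ ⊤ := by
  induction w generalizing s with
  | nil =>
    obtain rfl := A.eq_of_mwt_nil_ne_top h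
    exact ⟨r', hr, by rw [mwt_nil_self]; exact WithTop.zero_ne_top⟩
  | cons a w ih =>
    obtain ⟨t, ht⟩ := A.exists_mwt_cons a w s r
    rw [ht, WithTop.add_ne_top] at h
    obtain ⟨t', htt, ht'⟩ := ih (fun c hc => hw c (List.mem_cons_of_mem _ hc)) h.2
    cases a with
    | base p σ q =>
      rw [letterWt_base] at h
      obtain ⟨h1, h2, h3, h4, h5⟩ := A.baseWt_of_ne_top h.1
      have hm := t'.inner_mem
      rw [← htt.2, h3, reach, Finset.mem_filter] at hm
      obtain ⟨-, x, hx, hxw⟩ := hm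
      refine ⟨⟨x, s.base, s.set, hx, s.base_mem⟩, ⟨rfl, rfl⟩, ?_⟩
      refine ne_top_of_le_ne_top ?_ (A.mwt_cons_le _ _ _ t' _)
      rw [WithTop.add_ne_top, letterWt_base, baseWt,
        if_pos ⟨h1, htt.1.symm.trans h2, htt.2.symm.trans h3⟩]
      obtain ⟨z, hz⟩ := WithTop.ne_top_iff_exists.mp h5
      refine ⟨?_, ht'⟩
      rw [← hz, subWt_coe, WithTop.add_ne_top]
      exact ⟨hxw, WithTop.coe_ne_top⟩
    | _ => exact (hw _ List.mem_cons_self).elim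

/-- The set component of `s0` is a singleton, so `s0` is alone in its class. -/
theorem mwt_s0_ne_top_of_sameClass {w : List (Letter Q Sg)} (hw : ∀ a ∈ w, a.IsBase)
    {r r' : AState Q} (h : A.mwt w A.s0 r ≠ ⊤) (hr : r.SameClass r') : A.mwt w A.s0 r' ≠ ⊤ := by
  obtain ⟨s', hs, hs'⟩ := exists_sameClass_mwt_ne_top hw h hr
  have hin : s'.inner = A.init := by
    have := s'.inner_mem
    rw [← hs.2] at this
    exact Finset.mem_singleton.mp this
  rwa [AState.eq_of_components (y := A.s0) hin hs.1.symm hs.2.symm] at hs'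

theorem letterWt_le_wmax {a : Letter Q Sg} {s t : AState Q} (h : A.letterWt a s t ≠ ⊤) :
    A.letterWt a s t ≤ ((A.wmax a : ℤ) : WithTop ℤ) := by
  obtain ⟨z, hz⟩ := WithTop.ne_top_iff_exists.mp h
  have h1 := Finset.le_sup (f := fun e : AState Q × AState Q =>
    ((A.letterWt a e.1 e.2).untopD 0).natAbs) (Finset.mem_univ (s, t))
  simp only [← hz, WithTop.untopD_coe] at h1
  rw [← hz]
  have h2 : z.natAbs ≤ A.wmax a := h1
  exact_mod_cast (by omega)

theorem mwt_le_maxeff {w : List (Letter Q Sg)} {s t : AState Q} (h : A.mwt w s t ≠ ⊤) :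
    A.mwt w s t ≤ ((A.maxeff w : ℤ) : WithTop ℤ) := by
  induction w generalizing s with
  | nil =>
    obtain rfl := A.eq_of_mwt_nil_ne_top h
    simp [mwt_nil_self, maxeff]
  | cons a w ih =>
    obtain ⟨q, hq⟩ := A.exists_mwt_cons a w s t
    rw [hq] at h ⊢
    rw [WithTop.add_ne_top] at h
    have e : ((A.maxeff (a :: w) : ℤ) : WithTop ℤ) =
        ((A.wmax a : ℤ) : WithTop ℤ) + ((A.maxeff w : ℤ) : WithTop ℤ) := by
      rw [← WithTop.coe_add]; simp [maxeff]
    rw [e]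
    exact add_le_add (letterWt_le_wmax h.1) (ih h.2)

/-- A cycle of minimal mean yields, after a change of baseline, a stable cycle. -/
theorem exists_stable_rebase {L : ℕ → ℕ} {S₀ : Finset (AState Q)} {x : List (Letter Q Sg)}
    (hx : ∀ a ∈ x, A.IsCac L a) (hrefl : A.IsReflexiveCycle S₀ x)
    (hlen : stabConst Q * x.length ≤ L (Letter.wordDep x + 1)) {r : AState Q} (hr : r ∈ S₀)
    {n : ℕ} {W : ℤ} (hn : 1 ≤ n) (hn' : n ≤ Fintype.card (AState Q))
    (hW : A.mwt (wordPow x n) r r = W)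
    (hmin : ∀ t ∈ S₀, ∀ j, ∀ z : ℤ, A.mwt (wordPow x j) t t ≤ z → j * W ≤ n * z) :
    ∃ (S' : Finset (AState Q)) (x' : List (Letter Q Sg)), A.IsCacRebCac L (.cactus S' x') ∧
      A.IsStableCycle S' x' ∧ (∀ s, s ∈ S' ↔ s.base = r.inner ∧ s.set = r.set) ∧
      ∀ k, RebasesTo (A.mwt (wordPow x (n * k))) (A.mwt (wordPow x' k)) r r
        ((k * W : ℤ) : WithTop ℤ) := by
  have hxn : ∀ a ∈ wordPow x n, A.IsCac L a := fun a ha => hx a (mem_of_mem_wordPow ha)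
  obtain ⟨x', hx', -, hdep, hreb⟩ := exists_rebase_word (s := r) (r := r) hxn
    (by rw [hW]; exact WithTop.coe_ne_top)
  rw [hW] at hreb
  have hpow : ∀ k, RebasesTo (A.mwt (wordPow x (n * k))) (A.mwt (wordPow x' k)) r r
      ((k * W : ℤ) : WithTop ℤ) := by
    intro k
    rw [wordPow_mul]
    exact RebasesTo.wordPow hreb (fun y z hy hz =>
      classDet_mwt hxn r y r z hy (by rw [hW]; exact WithTop.coe_ne_top) hz) k
  set S' : Finset (AState Q) :=
    Finset.univ.filter fun s => s.base = r.inner ∧ s.set = r.set with hS'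
  have hmem : ∀ s, s ∈ S' ↔ s.base = r.inner ∧ s.set = r.set := by simp [hS']
  have hstab : A.IsStableCycle S' x' := by
    refine ⟨⟨⟨r.inner, r.set, hmem⟩, ?_⟩, ?_⟩
    · intro s hs t ht
      obtain ⟨s', hs'⟩ := AState.exists_rebased ((hmem s).mp hs).1 ((hmem s).mp hs).2
      exact (hmem t).mpr ((hreb s s' hs').2 t ht)
    · have hnn : ∀ k, ∀ s ∈ S', 0 ≤ A.mwt (wordPow x' k) s s := by
        intro k s hs
        obtain ⟨s', hs'⟩ := AState.exists_rebased ((hmem s).mp hs).1 ((hmem s).mp hs).2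
        have h1 := (hpow k s s' hs').1 s s' hs'
        by_cases htop : A.mwt (wordPow x' k) s s = ⊤
        · rw [htop]; exact le_top
        obtain ⟨z, hz⟩ := WithTop.ne_top_iff_exists.mp htop
        rw [← hz, ← WithTop.coe_add] at h1
        -- A cycle of `x'^k` of weight `z` is a cycle of `x^(n k)` of weight `z + k W`; minimality
        -- of the mean `W / n` gives `z ≥ 0`.
        have h2 := hmin s' (hrefl.mem_of_sameClass hr hs'.sameClass) (n * k) _ h1.ge
        have h3 : (n : ℤ) * (k * W) ≤ n * (z + k * W) := by
          push_cast at h2; linarith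
        have h4 := le_of_mul_le_mul_left h3 (by exact_mod_cast hn)
        rw [← hz]
        exact_mod_cast (by linarith)
      have hbm : (⟨r.inner, r.inner, r.set, r.inner_mem, r.inner_mem⟩ : AState Q) ∈ S' :=
        (hmem _).mpr ⟨rfl, rfl⟩
      refine ⟨_, hbm, rfl, fun k => ?_⟩
      have hle : A.mwt (wordPow x' k) ⟨r.inner, r.inner, r.set, r.inner_mem, r.inner_mem⟩
          ⟨r.inner, r.inner, r.set, r.inner_mem, r.inner_mem⟩ ≤ 0 := by
        have hb : AState.Rebased r ⟨r.inner, r.inner, r.set, r.inner_mem, r.inner_mem⟩ r :=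
          ⟨rfl, rfl, rfl, rfl, rfl⟩
        have h1 := (hpow k _ _ hb).1 _ _ hb
        have h2 := (A.powers x).mul_self_le (c := n) hW.le k
        simp only [← h1] at h2
        have h3 : A.mwt (wordPow x' k) ⟨r.inner, r.inner, r.set, r.inner_mem, r.inner_mem⟩
          ⟨r.inner, r.inner, r.set, r.inner_mem, r.inner_mem⟩ + ((k * W : ℤ) : WithTop ℤ) ≤
            0 + ((k * W : ℤ) : WithTop ℤ) := by rw [zero_add]; exact h2
        exact (WithTop.add_le_add_iff_right WithTop.coe_ne_top).mp h3
      exact ⟨mem_minStates_of_nonpos (hnn k) hbm hle, le_antisymm hle (hnn k _ hbm)⟩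
  refine ⟨S', x', .cactus S' x' hx' hstab ?_, hstab, hmem, hpow⟩
  have hd : Letter.wordDep x' = Letter.wordDep x := by
    rw [Letter.wordDep, hdep]
    -- Here `n ≥ 1` matters: the empty power has depth 0.
    obtain ⟨n', rfl⟩ := Nat.exists_eq_add_of_le' hn
    exact Letter.wordDep_wordPow x n'
  have hl : x'.length = n * x.length := by
    rw [← length_wordPow, ← List.length_map (f := Letter.dep) (as := x'), hdep, List.length_map]
  rw [hd, hl]
  exact (Nat.mul_le_mul_right _ (hn'.trans (Nat.le_mul_of_pos_right _
    (Nat.factorial_pos _)))).trans hlen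

/-- The lowest class of a separated repeating infix is closed under `x`, and cycles on it are
non-negative. -/
theorem closed_of_gap {u x : List (Letter Q Sg)} {V : Finset (AState Q)} {k : ℤ} (hk : 0 ≤ k)
    (hV : ∀ s ∈ V, A.xconf u s ≠ ⊤ ∧ A.xconf (u ++ x) s = A.xconf u s + k)
    (hgap : ∀ s ∈ V, ∀ t ∉ V, A.xconf (u ++ x) t ≠ ⊤ →
      A.xconf (u ++ x) s + ((A.maxeff x : ℤ) : WithTop ℤ) < A.xconf (u ++ x) t)
    (n : ℕ) {s t : AState Q} (hs : s ∈ V) (ht : A.mwt (wordPow x n) s t ≠ ⊤) :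
    t ∈ V ∧ A.xconf u t ≤ A.xconf u s + A.mwt (wordPow x n) s t := by
  have hk' : (0 : WithTop ℤ) ≤ (k : ℤ) := by exact_mod_cast hk
  induction n generalizing t with
  | zero =>
    obtain rfl := (A.powers x).eq_of_zero s t ht
    have h0 : A.mwt (wordPow x 0) s s = 0 := (A.powers x).zero_self s
    exact ⟨hs, by rw [h0, add_zero]⟩
  | succ n ih =>
    obtain ⟨q, hq⟩ := (A.powers x).exists_split n 1 s t
    simp only [wordPow_one] at hq
    rw [hq, WithTop.add_ne_top] at ht
    obtain ⟨hqV, hqle⟩ := ih ht.1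
    have h1 : A.xconf (u ++ x) t ≤ A.xconf u q + A.mwt x q t := A.mwt_append_le u x A.s0 q t
    have htV : t ∈ V := by
      -- A step out of `V` could raise the value by at most `maxeff x`, which the gap after `x`
      -- excludes because the shift `k` is nonnegative.
      by_contra htV
      have hfin : A.xconf (u ++ x) t ≠ ⊤ :=
        ne_top_of_le_ne_top (WithTop.add_ne_top.mpr ⟨(hV q hqV).1, ht.2⟩) h1
      have h2 := hgap q hqV t htV hfin
      rw [(hV q hqV).2] at h2
      have h3 : A.xconf u q + A.mwt x q t ≤
          A.xconf u q + (k : ℤ) + ((A.maxeff x : ℤ) : WithTop ℤ) :=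
        add_le_add (le_add_of_nonneg_right hk') (mwt_le_maxeff ht.2)
      exact absurd (h2.trans_le (h1.trans h3)) (lt_irrefl _)
    refine ⟨htV, ?_⟩
    rw [(hV t htV).2] at h1
    rw [hq, ← add_assoc]
    exact (le_add_of_nonneg_right hk').trans (h1.trans (add_le_add hqle le_rfl))

end WFA

/-! ### Ghost states, dominance and potential -/

namespace WFA

variable {Q Sg : Type*} [Fintype Q] [DecidableEq Q] {A : WFA Q Sg}

/-- The gaps between consecutive classes add up. -/
theorem gap_of_lt {S : Type*} {ℓ : ℕ} {V : Fin ℓ → Finset S} {c : S → WithTop ℤ} {G : ℕ}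
    (hne : ∀ j, (V j).Nonempty)
    (hgap : ∀ i j : Fin ℓ, (i : ℕ) + 1 = j → ∀ s ∈ V i, ∀ t ∈ V j, c s + (G : ℤ) < c t)
    {i j : Fin ℓ} (hij : i < j) : ∀ s ∈ V i, ∀ t ∈ V j, c s + (G : ℤ) < c t := by
  obtain ⟨d, hd⟩ : ∃ d, (i : ℕ) + d + 1 = j := ⟨j - i - 1, by have : (i : ℕ) < j := hij; omega⟩
  induction d generalizing j with
  | zero => exact hgap i j (by simpa using hd)
  | succ d ih =>
    intro s hs t ht
    let q : Fin ℓ := ⟨i + d + 1, by omega⟩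
    obtain ⟨y, hy⟩ := hne q
    have h1 := ih (j := q) (Fin.lt_def.mpr (by simp only [q]; omega)) rfl s hs y hy
    have h2 := hgap q j (by simp only [q]; omega) y hy t ht
    have h3 : c y ≤ c y + (G : ℤ) := le_add_of_nonneg_right (by exact_mod_cast Nat.zero_le G)
    exact h1.trans (h3.trans_lt h2)

theorem mem_reachable {u : List (Letter Q Sg)} {s : AState Q} :
    s ∈ A.reachable u ↔ A.xconf u s ≠ ⊤ := by
  simp [reachable]

theorem reachable_nonempty_of_seamless {u v : List (Letter Q Sg)}
    (h : A.HasSeamlessBaselineRun (u ++ v)) : (A.reachable u).Nonempty := by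
  obtain ⟨ρ, -, -, h⟩ := h
  obtain ⟨h1, h2⟩ := h u.length (by simp)
  rw [List.take_left' rfl] at h1 h2
  exact ⟨_, mem_reachable.mpr (h2 ▸ h1)⟩

/-- If the repeated word has no negative cycle on the ghost states, it is a stable cycle. -/
theorem isStableCycle_of_nonneg {L : ℕ → ℕ} {x : List (Letter Q Sg)} {S' : Finset (AState Q)}
    (hx : ∀ a ∈ x, A.IsCac L a) (hrefl : A.IsReflexiveCycle S' x) {s t : AState Q} (hs : s ∈ S')
    (ht : t ∈ S') (hst : A.mwt x s t ≠ ⊤)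
    (hnn : ∀ n, ∀ r ∈ S', 0 ≤ A.mwt (wordPow x n) r r) : A.IsStableCycle S' x := by
  have hcl : s.SameClass t := by
    obtain ⟨⟨q, T, hf⟩, -⟩ := hrefl
    exact hf.sameClass hs ht
  have hb : s.baseline ∈ S' := hrefl.mem_of_sameClass hs ⟨rfl, rfl⟩
  have hbt : t.baseline = s.baseline :=
    AState.IsBaseline.eq_of_sameClass rfl rfl ⟨hcl.symm.1, hcl.symm.2⟩
  have h1 := mwt_baseline_le hx hst
  rw [hbt] at h1
  refine ⟨hrefl, s.baseline, hb, rfl, fun n => ?_⟩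
  have h2 : A.mwt (wordPow x n) s.baseline s.baseline ≤ 0 := by
    have := (A.powers x).mul_self_le (c := 1) (x := 0) (v := s.baseline)
      (by simp only [wordPow_one]; exact h1) n
    simpa only [one_mul, mul_zero, WithTop.coe_zero] using this
  exact ⟨mem_minStates_of_nonpos (hnn n) hb h2, le_antisymm h2 (hnn n _ hb)⟩

/-- All states reached by `u` lie in one class, the ghost set. Equality of supports yields one run
on `x` inside it, and class determinism extends this to all runs. -/
theorem ghost_isReflexiveCycle {L : ℕ → ℕ} {u x : List (Letter Q Sg)}
    (hu : ∀ a ∈ u, A.IsCac L a) (hx : ∀ a ∈ x, A.IsCac L a)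
    (hsupp : A.reachable (u ++ x) = A.reachable u) (hne : (A.reachable u).Nonempty) :
    A.IsReflexiveCycle (A.ghost u) x ∧ (∀ s ∈ A.reachable u, s ∈ A.ghost u) ∧
      ∃ s ∈ A.ghost u, ∃ t ∈ A.ghost u, A.mwt x s t ≠ ⊤ := by
  obtain ⟨t, ht⟩ := hne
  have hdet : ∀ s ∈ A.reachable u, ∀ r ∈ A.reachable u, s.SameClass r := fun s hs r hr =>
    classDet_mwt hu _ _ s r (.refl A.s0) (mem_reachable.mp hs) (mem_reachable.mp hr)
  have hgh : ∀ s, s ∈ A.ghost u ↔ s.SameClass t := by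
    intro s
    simp only [ghost, Finset.mem_filter, Finset.mem_univ, true_and]
    constructor
    · rintro ⟨r, hr, h⟩
      exact AState.SameClass.trans h (hdet r hr t ht)
    · exact fun h => ⟨t, ht, h⟩
  have ht' := mem_reachable.mp (hsupp.symm ▸ ht)
  obtain ⟨s, hs⟩ := A.exists_mwt_append u x A.s0 t
  have hxt : A.mwt (u ++ x) A.s0 t ≠ ⊤ := ht'
  rw [hs, WithTop.add_ne_top] at hxt
  have hsr : s ∈ A.reachable u := mem_reachable.mpr hxt.1
  have hst := hdet s hsr t ht
  refine ⟨⟨⟨t.base, t.set, fun s => hgh s⟩, fun s' hs' r hr => ?_⟩,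
    fun s hs => (hgh s).mpr (hdet s hs t ht), s, (hgh s).mpr hst, t, (hgh t).mpr (.refl t), hxt.2⟩
  exact (hgh r).mpr (classDet_mwt hx s' s r t (((hgh s').mp hs').trans hst.symm) hr hxt.2)

variable [Fintype Sg]

theorem exists_isPotential {b : ℕ} {w : List (Letter Q Sg)} (hj : ∀ a ∈ w, ¬ a.IsJump)
    (hs : A.HasSeamlessBaselineRun w) {q : AState Q} (hq : A.IsDominant b (A.xconf w) q) {z : ℤ}
    (hz : (z : WithTop ℤ) ≤ A.xconf w q) : ∃ φ : ℤ, A.IsPotential b w φ ∧ z ≤ φ := by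
  classical
  obtain ⟨p, hp, hmax⟩ := Finset.exists_max_image
    (Finset.univ.filter fun q => A.IsDominant b (A.xconf w) q) (A.xconf w) ⟨q, by simpa using hq⟩
  simp only [Finset.mem_filter, Finset.mem_univ, true_and] at hp hmax
  obtain ⟨φ, hφ⟩ := WithTop.ne_top_iff_exists.mp hp.1
  refine ⟨φ, ⟨hj, hs, ⟨p, hp, hφ.symm⟩, ?_⟩, ?_⟩
  · rintro y ⟨r, hr, hy⟩
    have := hmax r hr
    rw [hy, ← hφ] at this
    exact_mod_cast this
  · have := hz.trans (hmax q hq)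
    rw [← hφ] at this
    exact_mod_cast this

/-- The lowest state from which a jump to the baseline of a stable cycle grounds in that cycle is
dominant. -/
theorem exists_isDominant {b : ℕ} {c : AState Q → WithTop ℤ} {S' : Finset (AState Q)}
    {x' : List (Letter Q Sg)} (ha : A.IsCacRebCac (A.Lgen b) (.cactus S' x'))
    (hstab : A.IsStableCycle S' x') {p : AState Q} (hp : p ∈ S') (hpb : p.IsBaseline)
    {q₀ : AState Q} (hq₀ : q₀.inner = p.inner) (hset : q₀.set = p.set) (hc : c q₀ ≠ ⊤) :
    ∃ q, A.IsDominant b c q ∧ q.SameClass q₀ ∧ ∃ q₁ ∈ S', q₁.inner = q.inner ∧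
      ∃ g ∈ S', A.mwt (wordPow x' (stabConst Q)) q₁ g ≠ ⊤ ∧
        A.mwt (wordPow x' (stabConst Q)) g g ≤ 0 := by
  classical
  set a : Letter Q Sg := .cactus S' x' with ha'
  let j : Letter Q Sg := .jump q₀ p
  -- The states able to read the suffix. A minimiser of `c` on this set is dominant by definition.
  let D : Finset (AState Q) := Finset.univ.filter fun q => ∃ r, A.mwt ([j] ++ [a]) q r ≠ ⊤
  have hmem : ∀ q, q ∈ D ↔ ∃ r, A.mwt ([j] ++ [a]) q r ≠ ⊤ := by simp [D]
  obtain ⟨b', hb', hbb, hst⟩ := hstab.2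
  have hq₀D : q₀ ∈ D := by
    obtain ⟨⟨q, T, hf⟩, -⟩ := hstab.1
    obtain rfl : p = b' := AState.IsBaseline.eq_of_sameClass hpb hbb (hf.sameClass hp hb')
    refine (hmem _).mpr ⟨p, ne_top_of_le_ne_top ?_ (A.mwt_append_le [j] [a] q₀ p p)⟩
    rw [mwt_singleton, mwt_singleton, WithTop.add_ne_top]
    constructor
    · rw [letterWt_jump, jumpWt, if_pos ⟨hq₀, rfl, rfl, rfl, rfl⟩]
      exact WithTop.zero_ne_top
    · refine ne_top_of_le_ne_top ?_ (A.letterWt_cactus_le hp hp (hst _).1)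
      rw [(hst _).2, add_zero]
      exact WithTop.zero_ne_top
  obtain ⟨q, hq, hmin⟩ := Finset.exists_min_image D c ⟨q₀, hq₀D⟩
  have hjl : A.IsCacRebJump (A.Lsimp b) j := .jump q₀ p hq₀ hset
  refine ⟨q, ⟨ne_top_of_le_ne_top hc (hmin q₀ hq₀D), [j], a, by simpa using hjl, ha,
    (hmem q).mp hq, ?_⟩, ?_⟩
  · intro p' hp' r
    by_contra hr
    exact absurd hp' (not_lt.mpr (hmin p' ((hmem p').mpr ⟨r, hr⟩)))
  · obtain ⟨r, hr⟩ := (hmem q).mp hq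
    obtain ⟨q₁, hq₁⟩ := A.exists_mwt_append [j] [a] q r
    rw [hq₁, WithTop.add_ne_top, mwt_singleton, mwt_singleton, letterWt_jump] at hr
    obtain ⟨h1, h2⟩ := hr
    rw [jumpWt] at h1
    split_ifs at h1 with hcond
    · obtain ⟨hs, -, g, hg, he⟩ := A.exists_of_letterWt_cactus_ne_top h2
      rw [he, WithTop.add_ne_top] at h2
      obtain ⟨hgS, hg0⟩ := hstab.of_mem_minStates hg
      exact ⟨⟨hcond.2.1, hcond.2.2.1⟩, q₁, hs, hcond.1.symm, g, hgS, h2.1, hg0⟩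
    · exact absurd rfl h1

end WFA

/-! ### The dichotomy -/

theorem mainTheorem7 {Q Sg : Type*} [Fintype Q] [DecidableEq Q] [Fintype Sg] (A : WFA Q Sg)
    (b : ℕ) (u x y v : List (Letter Q Sg)) (hw : A.IsGSRI b u x y v) :
    A.IsStableCycle (A.ghost u) x ∨
      ∃ w' : List (Letter Q Sg), (∀ a ∈ w', a.IsBase) ∧
        ∃ φ : ℤ, A.IsPotential b w' φ ∧ (A.H b : ℤ) ≤ φ := by
  obtain ⟨⟨hlet, hsx, -, hlen, ⟨ℓ, V, kx, ky, hVne, -, hVcov, hVgap, hVk, -⟩, hbase⟩, hch, -, -⟩ :=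
    hw
  set G : ℕ := 4 * Fintype.card (AState Q) * stabConst Q * A.maxeff (x ++ y) + A.H b with hG
  have hu : ∀ a ∈ u, A.IsCac (A.Lgen b) a := fun a ha => hlet a (by simp [ha])
  have hx : ∀ a ∈ x, A.IsCac (A.Lgen b) a := fun a ha => hlet a (by simp [ha])
  have hne : (A.reachable u).Nonempty := by
    rw [List.append_assoc, List.append_assoc] at hbase
    exact WFA.reachable_nonempty_of_seamless hbase
  obtain ⟨hrefl, hsub, s₁, hs₁, t₁, ht₁, hst₁⟩ := WFA.ghost_isReflexiveCycle hu hx hsx hne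
  by_cases hnn : ∀ n, ∀ r ∈ A.ghost u, 0 ≤ A.mwt (wordPow x n) r r
  · exact .inl (WFA.isStableCycle_of_nonneg hx hrefl hs₁ ht₁ hst₁ hnn)
  right
  push Not at hnn
  obtain ⟨n₀, r₀, hr₀, hneg⟩ := hnn
  obtain ⟨r, hr, n, W, hn, hn', hW, hW0, hmin⟩ :=
    (A.powers x).exists_min_mean_cycle hrefl.closed hr₀ hneg
  obtain ⟨S', x', hcac, hstab, hS', hreb⟩ :=
    WFA.exists_stable_rebase hx hrefl hlen hr hn hn' hW hmin
  -- the lowest class of reachable states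
  obtain ⟨f, hf, hfmin⟩ := Finset.exists_min_image (A.reachable u) (A.xconf u) hne
  have hfmin' : ∀ s, A.xconf u f ≤ A.xconf u s := by
    intro s
    by_cases hs : A.xconf u s = ⊤
    · rw [hs]; exact le_top
    · exact hfmin s (WFA.mem_reachable.mpr hs)
  obtain ⟨j₀, hfj⟩ := (hVcov f).mp hf
  have hℓ : 0 < ℓ := Fin.pos j₀
  have hgapu : ∀ {i j : Fin ℓ}, i < j → ∀ s ∈ V i, ∀ t ∈ V j,
      A.xconf u s + (G : ℤ) < A.xconf u t := fun hij =>
    WFA.gap_of_lt hVne (fun i j h s hs t ht => (hVgap i j h s hs t ht).1) hij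
  have hgapx : ∀ {i j : Fin ℓ}, i < j → ∀ s ∈ V i, ∀ t ∈ V j,
      A.xconf (u ++ x) s + (G : ℤ) < A.xconf (u ++ x) t := fun hij =>
    WFA.gap_of_lt hVne (fun i j h s hs t ht => (hVgap i j h s hs t ht).2.1) hij
  have hG0 : (0 : WithTop ℤ) ≤ ((G : ℤ) : WithTop ℤ) := by exact_mod_cast Nat.zero_le G
  let i₀ : Fin ℓ := ⟨0, hℓ⟩
  have hpos : ∀ j, j ≠ i₀ → i₀ < j := fun j hj =>
    lt_of_le_of_ne (Fin.le_def.mpr (Nat.zero_le _)) hj.symm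
  have hf0 : f ∈ V i₀ := by
    by_contra hcon
    have hj : j₀ ≠ i₀ := fun e => hcon (e ▸ hfj)
    obtain ⟨s, hs⟩ := hVne i₀
    have h1 := hgapu (hpos j₀ hj) s hs f hfj
    exact absurd ((le_add_of_nonneg_right hG0).trans_lt h1) (not_lt.mpr (hfmin' s))
  obtain ⟨cf, hcf⟩ := WithTop.ne_top_iff_exists.mp (WFA.mem_reachable.mp hf)
  -- The charge condition says the minimum does not drop along `x`, while the value of `f` moves to
  -- `cf + kx i₀`, an upper bound for the new minimum.
  have hk0 : 0 ≤ kx i₀ := by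
    have e1 : Finset.univ.inf (A.xconf u) = (cf : WithTop ℤ) := by
      rw [hcf]
      exact le_antisymm (Finset.inf_le (Finset.mem_univ f)) (Finset.le_inf fun s _ => hfmin' s)
    have h2 : Finset.univ.inf (A.xconf (u ++ x)) ≤ ((cf + kx i₀ : ℤ) : WithTop ℤ) := by
      rw [WithTop.coe_add, hcf, ← (hVk i₀ f hf0).1]
      exact Finset.inf_le (Finset.mem_univ f)
    obtain ⟨z, hz⟩ := WithTop.ne_top_iff_exists.mp (MinPlusPowers.ne_top_of_le_coe h2)
    rw [← hz] at h2
    have h3 : z ≤ cf + kx i₀ := by exact_mod_cast h2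
    rw [WFA.charge, WFA.charge, e1, ← hz, WithTop.untopD_coe, WithTop.untopD_coe] at hch
    omega
  have hmaxeff : ((A.maxeff x : ℤ) : WithTop ℤ) ≤ ((G : ℤ) : WithTop ℤ) := by
    have : Nonempty (AState Q) := ⟨f⟩
    have h1 : A.maxeff x ≤ A.maxeff (x ++ y) := by simp [WFA.maxeff]
    have h2 : A.maxeff (x ++ y) ≤
        4 * Fintype.card (AState Q) * stabConst Q * A.maxeff (x ++ y) :=
      Nat.le_mul_of_pos_left _ (Nat.mul_pos (Nat.mul_pos (by norm_num) Fintype.card_pos)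
        WFA.stabConst_pos)
    have h3 : A.maxeff x ≤ G := by omega
    exact_mod_cast h3
  have hclosed := fun (k : ℕ) {s t : AState Q} => WFA.closed_of_gap (A := A) (u := u) (x := x)
    (V := V i₀) hk0
    (fun s hs => ⟨WFA.mem_reachable.mp ((hVcov s).mpr ⟨_, hs⟩), (hVk i₀ s hs).1⟩)
    (by
      intro s hs t ht hfin
      obtain ⟨j, hj⟩ := (hVcov t).mp (hsx ▸ WFA.mem_reachable.mpr hfin)
      have hji : j ≠ i₀ := fun e => ht (e ▸ hj)
      exact (add_le_add le_rfl hmaxeff).trans_lt (hgapx (hpos j hji) s hs t hj)) k (s := s) (t := t)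
  -- unfold `u` and choose the run to `f` as the baseline
  obtain ⟨u', hu', hagree⟩ := WFA.flattenable_of_letters (fun a ha => (hu a ha).flattenable)
    (cf + A.H b)
  have hagr := hagree A.s0 ⟨A.s0, f, .refl _, WFA.mem_reachable.mp hf⟩
  have hfu' : A.mwt u' A.s0 f = (cf : WithTop ℤ) := by
    rw [(hagr f).1 (WFA.mem_reachable.mp hf), hcf]; rfl
  have hu'C : ∀ a ∈ u', A.IsCac 0 a := fun a ha => .of_isBase _ (hu' a ha)
  obtain ⟨w', -, hw'b, -, hw'⟩ := WFA.exists_rebase_word hu'C (s := A.s0) (r := f)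
    (by rw [hfu']; exact WithTop.coe_ne_top)
  have hw'B := hw'b hu'
  obtain ⟨hw'1, hw'2⟩ := hw' A.s0 A.s0 ⟨rfl, rfl, rfl, rfl, rfl⟩
  rw [hfu'] at hw'1
  have hrf : f.SameClass r := by
    obtain ⟨⟨q, T, hfull⟩, -⟩ := hrefl
    exact hfull.sameClass (hsub f hf) hr
  -- The ghost state `r` may be unreached by `u`, but the flat word `u'` reaches the whole class; so
  -- its copy is available after `w'`.
  have hq₀ : A.xconf w' ⟨r.inner, f.inner, f.set, hrf.2 ▸ r.inner_mem, f.inner_mem⟩ ≠ ⊤ := by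
    have h1 := hw'1 ⟨r.inner, f.inner, f.set, hrf.2 ▸ r.inner_mem, f.inner_mem⟩ r
      ⟨rfl, rfl, rfl, hrf.1.symm, hrf.2.symm⟩
    have h2 := WFA.mwt_s0_ne_top_of_sameClass hu' (by rw [hfu']; exact WithTop.coe_ne_top) hrf
    rw [← h1, WithTop.add_ne_top] at h2
    exact h2.1
  obtain ⟨q, hq, hqcl, q₁, hq₁, hin, g, hg, hqg, hgg⟩ := WFA.exists_isDominant (b := b)
    (c := A.xconf w') hcac hstab
    (p := ⟨r.inner, r.inner, r.set, r.inner_mem, r.inner_mem⟩) ((hS' _).mpr ⟨rfl, rfl⟩) rfl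
    (q₀ := ⟨r.inner, f.inner, f.set, hrf.2 ▸ r.inner_mem, f.inner_mem⟩) rfl hrf.2 hq₀
  refine ⟨w', hw'B, WFA.exists_isPotential ?_ ?_ hq ?_⟩
  · intro a ha hj
    have := hw'B a ha
    cases a <;> simp [Letter.IsBase, Letter.IsJump] at this hj
  · have hbf : AState.Rebased f ⟨f.inner, f.inner, f.set, f.inner_mem, f.inner_mem⟩ f :=
      ⟨rfl, rfl, rfl, rfl, rfl⟩
    have h0 : A.mwt w' A.s0 ⟨f.inner, f.inner, f.set, f.inner_mem, f.inner_mem⟩ = 0 := by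
      have h1 := hw'1 _ _ hbf
      rw [hfu'] at h1
      have h2 : A.mwt w' A.s0 ⟨f.inner, f.inner, f.set, f.inner_mem, f.inner_mem⟩ + cf =
        0 + (cf : WithTop ℤ) := by rw [h1, zero_add]
      exact WithTop.add_right_cancel WithTop.coe_ne_top h2
    exact WFA.hasSeamlessBaselineRun_of_mwt (L := 0) (fun a ha => .of_isBase _ (hw'B a ha))
      (r := ⟨f.inner, f.inner, f.set, f.inner_mem, f.inner_mem⟩)
      (by rw [h0]; exact WithTop.zero_ne_top) (le_of_eq h0.symm)
  -- Back in the original baseline, values are shifted by `cf`; it suffices that `q'` lies at height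
  -- at least `cf + H` after `u'`.
  · obtain ⟨q', hq'⟩ := AState.exists_rebased (s := f) (x := q) hqcl.1 hqcl.2
    have hval := hw'1 q q' hq'
    have hlow : ((cf + A.H b : ℤ) : WithTop ℤ) ≤ A.mwt u' A.s0 q' := by
      by_cases htop : A.xconf u q' = ⊤
      · exact (hagr q').2 htop
      rw [(hagr q').1 htop]
      obtain ⟨j, hj⟩ := (hVcov q').mp (WFA.mem_reachable.mpr htop)
      by_cases hji : j = i₀
      -- In the lowest class, `q'` would reach `g'`, still in that class and carrying a cycle of
      -- weight at most `𝔪 W < 0`, against `hclosed`.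
      · exfalso
        subst hji
        have hq₁' : AState.Rebased r q₁ q' := ⟨((hS' _).mp hq₁).1, ((hS' _).mp hq₁).2,
          hq'.inner_eq.trans hin.symm, hq'.base_eq'.trans hrf.1, hq'.set_eq'.trans hrf.2⟩
        obtain ⟨g', hg'⟩ := AState.exists_rebased ((hS' _).mp hg).1 ((hS' _).mp hg).2
        have h1 := (hreb (stabConst Q) q₁ q' hq₁').1 g g' hg'
        have h2 := (hreb (stabConst Q) g g' hg').1 g g' hg'
        have hfin : A.mwt (wordPow x (n * stabConst Q)) q' g' ≠ ⊤ := by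
          rw [← h1, WithTop.add_ne_top]
          exact ⟨hqg, WithTop.coe_ne_top⟩
        have hg'V := (hclosed _ hj hfin).1
        have hle : A.mwt (wordPow x (n * stabConst Q)) g' g' ≤
            ((stabConst Q * W : ℤ) : WithTop ℤ) := by
          rw [← h2]
          exact (add_le_add hgg le_rfl).trans_eq (zero_add _)
        have h3 := (hclosed _ hg'V (MinPlusPowers.ne_top_of_le_coe hle)).2
        obtain ⟨cg, hcg⟩ := WithTop.ne_top_iff_exists.mp
          (WFA.mem_reachable.mp ((hVcov g').mpr ⟨_, hg'V⟩))
        rw [← hcg] at h3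
        have h4 := h3.trans (add_le_add le_rfl hle)
        rw [← WithTop.coe_add] at h4
        have h5 : cg ≤ cg + stabConst Q * W := by exact_mod_cast h4
        have : Nonempty (AState Q) := ⟨f⟩
        have h6 : (stabConst Q : ℤ) * W < 0 :=
          mul_neg_of_pos_of_neg (by exact_mod_cast WFA.stabConst_pos (Q := Q)) hW0
        omega
      · have h1 := hgapu (hpos j hji) f hf0 q' hj
        rw [← hcf, ← WithTop.coe_add] at h1
        have h2 : cf + (A.H b : ℤ) ≤ cf + (G : ℤ) := by
          have : A.H b ≤ G := Nat.le_add_left _ _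
          omega
        exact (WithTop.coe_le_coe.mpr h2).trans h1.le
    rw [← hval, add_comm cf, WithTop.coe_add] at hlow
    exact (WithTop.add_le_add_iff_right WithTop.coe_ne_top).mp hlow
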